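/- Let $\mathbb G$ be a Carnot group of step two: a simply connected Lie group whose Lie algebra splits as $\mathfrak g=V_1\oplus V_2$ with $[V_1,V_1]=V_2\neq\{0\}$ and $[V_1,V_2]=\{0\}$. Fix an inner product on $\mathfrak g$ with $V_1\perp V_2$, let $e_1,\dots,e_m$ be an orthonormal basis of $V_1$ and $X_1,\dots,X_m$ the corresponding left-invariant vector fields, endow $\mathbb G$ with the associated left-invariant Riemannian metric, and identify $\mathbb G$ with $\mathfrak g$ by the exponential map; $dg$ is Lebesgue measure in these coordinates. Let $\mathcal Z$ be the generator of the dilations $\delta_\lambda(x+t)=\lambda x+\lambda^2t$ ($x\in V_1$, $t\in V_2$), that is, $\mathcal Z=\sum_i x_iX_i+2\sum_s t_sT_s$, with $T_s$ the left-invariant fields of an orthonormal basis of $V_2$. Let $\Omega\subset\mathbb G$ be a bounded $C^2$ open set, i.e. $\Omega=\{\varphi<0\}$ with $\varphi\in C^2(\mathbb G)$ and $d\varphi\ne0$ on $\partial\Omega$. Let $\boldsymbol\nu=\nabla\varphi/|\nabla\varphi|$ be the outer Riemannian unit normal of $\partial\Omega$, $\boldsymbol N^H=\sum_{j}\langle\boldsymbol\nu,X_j\rangle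 X_j$, $W=|\boldsymbol N^H|$, and, where $W\neq0$, $\boldsymbol\nu^H=\boldsymbol N^H/W$. At the points of $\partial\Omega$ with $W\ne0$ the horizontal mean curvature is $\mathcal H=\sum_{i=1}^{m-1}\langle\nabla^H_{E_i}E_i,\boldsymbol\nu^H\rangle$, where $E_1,\dots,E_{m-1}$ is a local $C^1$ orthonormal frame of $T\partial\Omega\cap H\mathbb G$, $H\mathbb G$ is the span of $X_1,\dots,X_m$, and $\nabla^H_A\big(\sum_jB_jX_j\big)=\sum_jA(B_j)X_j$. Suppose that for some $M,\alpha>0$ $$\sup_{\partial\Omega\cap\{W\neq0\}}|\mathcal H|\le M,\qquad\langle\mathcal Z,\boldsymbol\nu\rangle\ge\alpha W\ \text{ on }\partial\Omega .$$ Then there is a constant $C=C(\mathbb G,\Omega,M,\alpha)>0$ such that $$\sum_{i,j=1}^m\int_\Omega([X_i,X_j]u)^2\,dg\le C\int_\Omega(\Delta_Hu)^2\,dg,\qquad \Delta_Hu=\sum_{i=1}^mX_i^2u,$$ for every $u\in\Gamma^3(\overline\Omega)\cap C^2(\overline\Omega)$ with $u=0$ on $\partial\Omega$ that is $H_2$-convex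 in $\Omega$. Here $u\in\Gamma^3(\overline\Omega)$ means that $u$ is continuous on $\overline\Omega$ and that all derivatives $X_{j_1}\cdots X_{j_s}u$, $1\le s\le3$, exist in $\Omega$ and extend continuously to $\overline\Omega$; and $u$ is $H_2$-convex in $\Omega$ if at every point of $\Omega$ the first and the second elementary symmetric functions of the eigenvalues of the symmetrized Hessian $\big[\tfrac12(X_iX_ju+X_jX_iu)\big]_{i,j=1}^m$ are nonnegative. -/

import Mathlib

open MeasureTheory Topology
open scoped InnerProductSpace

noncomputable section

/-- A stratified Lie algebra of step two on the Euclidean space `𝔤`: `𝔤 = V₁ ⊕ V₂` (orthogonal sum),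
`[V₁, V₁] = V₂ ≠ 0`, `[V₁, V₂] = 0`, with an orthonormal basis `e₁, …, e_m` of the first layer.
The associated Carnot group (a simply connected Lie group) is written in exponential coordinates:
its underlying manifold is `𝔤`, and its law is the Baker-Campbell-Hausdorff product `mul` below. -/
structure StepTwoCarnot (m : ℕ) (𝔤 : Type*) [NormedAddCommGroup 𝔤] [InnerProductSpace ℝ 𝔤] where
  /-- the Lie bracket -/
  bracket : 𝔤 →ₗ[ℝ] 𝔤 →ₗ[ℝ] 𝔤
  bracket_self : ∀ x, bracket x x = 0
  jacobi : ∀ x y z,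
    bracket x (bracket y z) + bracket y (bracket z x) + bracket z (bracket x y) = 0
  /-- the horizontal layer -/
  V₁ : Submodule ℝ 𝔤
  /-- the second layer -/
  V₂ : Submodule ℝ 𝔤
  isCompl : IsCompl V₁ V₂
  orthogonal : V₁ ⟂ V₂
  bracket_V₁_V₁ : Submodule.span ℝ {z | ∃ x ∈ V₁, ∃ y ∈ V₁, bracket x y = z} = V₂
  bracket_V₁_V₂ : ∀ x ∈ V₁, ∀ t ∈ V₂, bracket x t = 0
  V₂_ne_bot : V₂ ≠ ⊥
  /-- the orthonormal basis of the horizontal layer -/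
  e : OrthonormalBasis (Fin m) ℝ V₁

namespace StepTwoCarnot

variable {m : ℕ} {𝔤 : Type*} [NormedAddCommGroup 𝔤] [InnerProductSpace ℝ 𝔤]
  (G : StepTwoCarnot m 𝔤)

/-! ### The group -/

theorem bracket_skew (x y : 𝔤) : G.bracket x y = -G.bracket y x := by
  have h := G.bracket_self (x + y)
  simp only [map_add, LinearMap.add_apply, G.bracket_self, zero_add, add_zero] at h
  exact eq_neg_of_add_eq_zero_right h

theorem exists_decomp (x : 𝔤) : ∃ a ∈ G.V₁, ∃ t ∈ G.V₂, a + t = x :=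
  Submodule.mem_sup.1 (G.isCompl.sup_eq_top ▸ Submodule.mem_top)

theorem bracket_V₂ (x t : 𝔤) (ht : t ∈ G.V₂) : G.bracket x t = 0 := by
  have key : ∀ s ∈ G.V₂, G.bracket s t = 0 := by
    intro s hs
    rw [← G.bracket_V₁_V₁] at hs
    induction hs using Submodule.span_induction with
    | mem z hz =>
      obtain ⟨a, ha, b, hb, rfl⟩ := hz
      have h := G.jacobi a b t
      rw [G.bracket_V₁_V₂ b hb t ht, G.bracket_skew t a, G.bracket_V₁_V₂ a ha t ht] at h
      rw [G.bracket_skew]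
      simpa using h
    | zero => simp
    | add a b _ _ ha hb => simp [ha, hb]
    | smul c a _ ha => simp [ha]
  obtain ⟨a, ha, s, hs, rfl⟩ := G.exists_decomp x
  simp [G.bracket_V₁_V₂ a ha t ht, key s hs]

theorem bracket_mem_V₂ (x y : 𝔤) : G.bracket x y ∈ G.V₂ := by
  obtain ⟨a, ha, s, hs, rfl⟩ := G.exists_decomp x
  obtain ⟨b, hb, t, ht, rfl⟩ := G.exists_decomp y
  have h : G.bracket (a + s) (b + t) = G.bracket a b := by
    rw [map_add, G.bracket_V₂ _ t ht, add_zero, G.bracket_skew, map_add, G.bracket_V₂ _ s hs,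
      add_zero, ← G.bracket_skew]
  rw [h, ← G.bracket_V₁_V₁]
  exact Submodule.subset_span ⟨a, ha, b, hb, rfl⟩

/-- The group law in exponential coordinates (Baker-Campbell-Hausdorff formula of step two). -/
def mul (x y : 𝔤) : 𝔤 := x + y + (1 / 2 : ℝ) • G.bracket x y

/-- The product `mul` is a group law, with unit `0` and inverse `-x`. -/
@[reducible] def toGroup : Group 𝔤 where
  mul := G.mul
  one := 0
  inv x := -x
  mul_assoc x y z := by
    change G.mul (G.mul x y) z = G.mul x (G.mul y z)
    have h1 : G.bracket (G.bracket x y) z = 0 := by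
      rw [G.bracket_skew, G.bracket_V₂ _ _ (G.bracket_mem_V₂ x y), neg_zero]
    have h2 : G.bracket x (G.bracket y z) = 0 := G.bracket_V₂ _ _ (G.bracket_mem_V₂ y z)
    simp only [mul, map_add, map_smul, LinearMap.add_apply, LinearMap.smul_apply, h1, h2,
      smul_zero, add_zero, smul_add]
    abel
  one_mul x := by
    change G.mul 0 x = x
    simp [mul]
  mul_one x := by
    change G.mul x 0 = x
    simp [mul]
  inv_mul_cancel x := by
    change G.mul (-x) x = 0
    simp [mul, G.bracket_self]

/-- The differential at the identity of the left translation by `g`, so that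
`g ↦ G.leftInv ξ g` is the left-invariant vector field generated by `ξ ∈ 𝔤`. -/
def leftInv (ξ g : 𝔤) : 𝔤 := ξ + (1 / 2 : ℝ) • G.bracket g ξ

theorem hasDerivAt_mul_smul (g ξ : 𝔤) :
    HasDerivAt (fun t : ℝ => G.mul g (t • ξ)) (G.leftInv ξ g) 0 := by
  have h : (fun t : ℝ => G.mul g (t • ξ)) = fun t : ℝ => g + t • G.leftInv ξ g := by
    funext t
    simp only [mul, leftInv, map_smul, smul_add, smul_comm t (1 / 2 : ℝ)]
    abel
  rw [h]
  simpa using ((hasDerivAt_id (0 : ℝ)).smul_const (G.leftInv ξ g)).const_add g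

/-! ### Horizontal calculus -/

/-- `X_i f`, the derivative of `f` along the left-invariant vector field generated by `e_i`
(the curve `t ↦ g exp (t e_i)` is the straight line `g + t X_i(g)`). -/
def X (i : Fin m) (f : 𝔤 → ℝ) (g : 𝔤) : ℝ := lineDeriv ℝ f g (G.leftInv (G.e i : 𝔤) g)

/-- The iterated derivative `X_{j₁} X_{j₂} ⋯ X_{j_s} u` along the word `[j₁, …, j_s]`. -/
def iterX (w : List (Fin m)) (u : 𝔤 → ℝ) : 𝔤 → ℝ := w.foldr G.X u

/-- The commutator `[X_i, X_j] u`. -/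
def comm (i j : Fin m) (u : 𝔤 → ℝ) (g : 𝔤) : ℝ := G.X i (G.X j u) g - G.X j (G.X i u) g

/-- The horizontal Laplacian `Δ_H u = ∑ X_i² u`. -/
def laplacian (u : 𝔤 → ℝ) (g : 𝔤) : ℝ := ∑ i, G.X i (G.X i u) g

/-- The symmetrized horizontal Hessian. -/
def symHess (u : 𝔤 → ℝ) (g : 𝔤) : Matrix (Fin m) (Fin m) ℝ :=
  Matrix.of fun i j => (G.X i (G.X j u) g + G.X j (G.X i u) g) / 2

theorem symHess_isHermitian (u : 𝔤 → ℝ) (g : 𝔤) : (G.symHess u g).IsHermitian := by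
  ext i j
  simp [symHess, add_comm]

/-- `F_r[u]`, the `r`-th elementary symmetric function of the eigenvalues of the symmetrized
horizontal Hessian. -/
def hessianOp (r : ℕ) (u : 𝔤 → ℝ) (g : 𝔤) : ℝ :=
  ∑ s ∈ Finset.powersetCard r (Finset.univ : Finset (Fin m)),
    ∏ i ∈ s, (G.symHess_isHermitian u g).eigenvalues i

/-- `u` is `H_r`-convex in `Ω`. -/
def HConvexOn (r : ℕ) (u : 𝔤 → ℝ) (Ω : Set 𝔤) : Prop :=
  ∀ k, 1 ≤ k → k ≤ r → ∀ g ∈ Ω, 0 ≤ G.hessianOp k u g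

/-- The Folland-Stein class `Γ^k` of the closure of `Ω`: the derivatives of `u` of order at most
`k` along the horizontal vector fields exist in `Ω` and extend continuously to the closure. -/
structure FollandStein (k : ℕ) (u : 𝔤 → ℝ) (Ω : Set 𝔤) : Prop where
  continuousOn : ContinuousOn u (closure Ω)
  exists_deriv : ∀ w : List (Fin m), w.length < k → ∀ i, ∀ g ∈ Ω,
    LineDifferentiableAt ℝ (G.iterX w u) g (G.leftInv (G.e i : 𝔤) g)
  extend : ∀ w : List (Fin m), w.length ≤ k →
    ∃ v : 𝔤 → ℝ, ContinuousOn v (closure Ω) ∧ Set.EqOn (G.iterX w u) v Ω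

/-! ### Dilations -/

variable [FiniteDimensional ℝ 𝔤]

/-- The group dilation `δ_c`, which is multiplication by `c` on `V₁` and by `c²` on `V₂`. -/
def dilation (c : ℝ) (g : 𝔤) : 𝔤 :=
  c • G.V₁.starProjection g + c ^ 2 • G.V₂.starProjection g

/-- The components, in the left-invariant frame, of the generator of the dilations: in exponential
coordinates, `Z = ∑ x_i X_i + 2 ∑ t_s T_s`. -/
def dilationField (g : 𝔤) : 𝔤 := G.V₁.starProjection g + (2 : ℝ) • G.V₂.starProjection g

theorem starProjection_add (g : 𝔤) : G.V₁.starProjection g + G.V₂.starProjection g = g := by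
  obtain ⟨a, ha, t, ht, rfl⟩ := G.exists_decomp g
  have h1 : G.V₁.starProjection t = 0 :=
    (Submodule.starProjection_apply_eq_zero_iff _).2 (G.orthogonal.symm ht)
  have h2 : G.V₂.starProjection a = 0 :=
    (Submodule.starProjection_apply_eq_zero_iff _).2 (G.orthogonal ha)
  rw [map_add, map_add, h1, h2, Submodule.starProjection_eq_self_iff.2 ha,
    Submodule.starProjection_eq_self_iff.2 ht, add_zero, zero_add]

theorem hasDerivAt_dilation (g : 𝔤) :
    HasDerivAt (fun c : ℝ => G.dilation c g) (G.leftInv (G.dilationField g) g) 1 := by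
  have h0 : G.bracket g (G.dilationField g) = 0 := by
    have h2 : G.dilationField g = g + G.V₂.starProjection g := by
      rw [dilationField, two_smul, ← add_assoc, G.starProjection_add]
    rw [h2, map_add, G.bracket_self, zero_add]
    exact G.bracket_V₂ _ _ (Submodule.starProjection_apply_mem _ _)
  have h := ((hasDerivAt_id (1 : ℝ)).smul_const (G.V₁.starProjection g)).add
    (((hasDerivAt_id (1 : ℝ)).pow 2).smul_const (G.V₂.starProjection g))
  rw [leftInv, h0, smul_zero, add_zero]
  convert h using 1
  · funext c
    simp [dilation]
  · simp [dilationField]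

/-! ### Geometry of the boundary

The metric on the group is the left-invariant one that coincides with the inner product of `𝔤` at
the identity. A tangent vector at `g` is represented by its components in the left-invariant frame,
i.e. by the `ξ ∈ 𝔤` for which it equals `G.leftInv ξ g`; its Riemannian norm is then `‖ξ‖`, and it
is horizontal if and only if `ξ ∈ G.V₁`. -/

/-- The Riemannian gradient of `φ` (for the left-invariant metric). -/
def grad (φ : 𝔤 → ℝ) (g : 𝔤) : 𝔤 :=
  ∑ a, fderiv ℝ φ g (G.leftInv (stdOrthonormalBasis ℝ 𝔤 a) g) • stdOrthonormalBasis ℝ 𝔤 a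

/-- The Riemannian unit normal `∇φ / |∇φ|`; for a defining function `φ` of `Ω` this is
the outer unit normal on the boundary of `Ω`. -/
def normal (φ : 𝔤 → ℝ) (g : 𝔤) : 𝔤 := ‖G.grad φ g‖⁻¹ • G.grad φ g

/-- The horizontal normal `N^H`, the projection of the normal on the horizontal bundle. -/
def horNormal (φ : 𝔤 → ℝ) (g : 𝔤) : 𝔤 := ∑ j, ⟪G.normal φ g, (G.e j : 𝔤)⟫_ℝ • (G.e j : 𝔤)

/-- The angle function `W = |N^H|`. -/
def angle (φ : 𝔤 → ℝ) (g : 𝔤) : ℝ := ‖G.horNormal φ g‖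

/-- The horizontal Gauss map `ν^H = N^H / |N^H|` (meaningful where `W ≠ 0`). -/
def gaussMap (φ : 𝔤 → ℝ) (g : 𝔤) : 𝔤 := (G.angle φ g)⁻¹ • G.horNormal φ g

/-- The horizontal Levi-Civita connection `∇^H_A B = ∑_j A(B_j) X_j`, for horizontal vector fields
`A` and `B = ∑_j B_j X_j`. -/
def horConn (A B : 𝔤 → 𝔤) (g : 𝔤) : 𝔤 :=
  ∑ j, fderiv ℝ (fun x => ⟪B x, (G.e j : 𝔤)⟫_ℝ) g (G.leftInv (A g) g) • (G.e j : 𝔤)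

/-- `h` is the horizontal mean curvature `∑ ⟨∇^H_{E_i} E_i, ν^H⟩` of the boundary of `Ω` at its
non-characteristic point `g`, where `E_1, …, E_{m-1}` are `C¹` vector fields near `g` which along
the boundary are an orthonormal basis of the horizontal tangent bundle. -/
def IsHorMeanCurvature (Ω : Set 𝔤) (φ : 𝔤 → ℝ) (g : 𝔤) (h : ℝ) : Prop :=
  ∃ E : Fin (m - 1) → 𝔤 → 𝔤,
    (∀ i, ContDiffAt ℝ 1 (E i) g) ∧
    (∀ᶠ x in 𝓝[frontier Ω] g, Orthonormal ℝ (fun i => E i x) ∧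
      ∀ i, E i x ∈ G.V₁ ∧ fderiv ℝ φ x (G.leftInv (E i x) x) = 0) ∧
    h = ∑ i, ⟪G.horConn (E i) (E i) g, G.gaussMap φ g⟫_ℝ

end StepTwoCarnot

/-- `φ` is a `C²` defining function of `Ω`: `Ω = {φ < 0}`, and the differential of `φ` does not
vanish on the boundary of `Ω`. -/
structure IsDefiningFunction {𝔤 : Type*} [NormedAddCommGroup 𝔤] [InnerProductSpace ℝ 𝔤]
    (φ : 𝔤 → ℝ) (Ω : Set 𝔤) : Prop where
  contDiff : ContDiff ℝ 2 φ
  eq_setOf : Ω = {g | φ g < 0}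
  fderiv_ne_zero : ∀ g ∈ frontier Ω, fderiv ℝ φ g ≠ 0

end

/-! The estimate comes from two divergence identities combined so that their boundary terms have a
sign. Write T_ij = [X_i, X_j]. The field `hessianField` is quadratic in the derivatives of u, and
its divergence is 2 F₂[u] + 3/4 ∑ (T_ij u)²: the third-order terms cancel because the commutators
are central (`isDivergence_hessian`, `hessianDiv_eq`). By convexity F₂ ≥ 0, so the commutators are
controlled once the flux through the boundary is.

Since u = 0 on ∂Ω, its gradient there is c ∇φ, and its tangential second derivatives are c times
those of φ (`exists_jet_extension`). The flux density against dφ is therefore c² (|∇ᴴφ|² Δ_H φ -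
Hess φ(∇ᴴφ, ∇ᴴφ)) (`fderiv_hessianField`). Up to sign this is c² |∇ᴴφ|³ times the horizontal mean
curvature, so it is at most M c² |∇ᴴφ|³; at characteristic points it vanishes. The Rellich field 2
Zu ∇ᴴu - |∇ᴴu|² Z has flux density c² |∇ᴴφ|² Zφ ≥ α c² |∇ᴴφ|³, by the star-shapedness condition.
Hence `hessianField` minus M/α times the Rellich field points inwards, and its divergence has
nonpositive integral.

It remains to absorb the interior Rellich terms 2 Zu Δ_H u + (2 - Q)|∇ᴴu|², with Q the homogeneous
dimension. On a bounded set (Zu)² is bounded by |∇ᴴu|² + ∑ (T_ij u)², because the commutators span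
V₂ (`exists_jetZ_sq_le`); Young's inequality then absorbs a small multiple of the commutators.
Finally ∫ |∇ᴴu|² is bounded by ∫ (Δ_H u)² through the energy identity and a Poincaré inequality,
both of which are also divergence identities with zero boundary values.

The fields contain second derivatives of u, so for u of class C² their divergence cannot be computed
directly. Every identity is stated on second-order jets, proved for smooth functions, and
transferred by mollification (`integral_jet_eq_zero`). The divergence theorem
(`setIntegral_div_nonpos`) is proved with cutoffs depending on φ, without a surface measure. -/

noncomputable section

set_option linter.unusedSectionVars false

/-! ### Divergence, second-order jets and their smooth approximation -/

section Calculus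

variable {E : Type*} [NormedAddCommGroup E] [InnerProductSpace ℝ E] [FiniteDimensional ℝ E]

/-- The Euclidean divergence of a vector field. -/
def euclDiv (F : E → E) (g : E) : ℝ := LinearMap.trace ℝ E (fderiv ℝ F g : E →ₗ[ℝ] E)

theorem euclDiv_eq_sum (F : E → E) (g : E) :
    euclDiv F g = ∑ a, ⟪stdOrthonormalBasis ℝ E a, fderiv ℝ F g (stdOrthonormalBasis ℝ E a)⟫_ℝ := by
  rw [euclDiv, LinearMap.trace_eq_sum_inner _ (stdOrthonormalBasis ℝ E)]
  rfl

theorem euclDiv_add {F F' : E → E} {g : E} (hF : DifferentiableAt ℝ F g)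
    (hF' : DifferentiableAt ℝ F' g) :
    euclDiv (fun x => F x + F' x) g = euclDiv F g + euclDiv F' g := by
  simp [euclDiv, fderiv_fun_add hF hF']

theorem euclDiv_sum {ι : Type*} (s : Finset ι) {F : ι → E → E} {g : E}
    (hF : ∀ i ∈ s, DifferentiableAt ℝ (F i) g) :
    euclDiv (fun x => ∑ i ∈ s, F i x) g = ∑ i ∈ s, euclDiv (F i) g := by
  simp [euclDiv, fderiv_fun_sum hF]

theorem euclDiv_smul {f : E → ℝ} {F : E → E} {g : E} (hf : DifferentiableAt ℝ f g)
    (hF : DifferentiableAt ℝ F g) :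
    euclDiv (fun x => f x • F x) g = f g * euclDiv F g + fderiv ℝ f g (F g) := by
  rw [euclDiv, fderiv_fun_smul hf hF]
  simp only [ContinuousLinearMap.toLinearMap_add, ContinuousLinearMap.toLinearMap_smul,
    map_add, map_smul, smul_eq_mul, euclDiv]
  congr 1
  exact LinearMap.trace_smulRight _ _

theorem continuous_euclDiv {F : E → E} (hF : ContDiff ℝ 1 F) : Continuous (euclDiv F) := by
  have h : euclDiv F = fun g => ∑ a, ⟪stdOrthonormalBasis ℝ E a,
      fderiv ℝ F g (stdOrthonormalBasis ℝ E a)⟫_ℝ := funext (euclDiv_eq_sum F)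
  have := hF.continuous_fderiv one_ne_zero
  rw [h]
  fun_prop

/-! ### Second-order jets -/

variable (E) in
/-- The space of second-order jets of functions at a point: value, gradient, Hessian. -/
abbrev Jet : Type _ := ℝ × E × (E →L[ℝ] E)

/-- The second-order jet of a function. -/
def jet (u : E → ℝ) (g : E) : Jet E := (u g, gradient u g, fderiv ℝ (gradient u) g)

theorem contDiff_gradient {u : E → ℝ} {n : WithTop ℕ∞} (hu : ContDiff ℝ (n + 1) u) :
    ContDiff ℝ n (gradient u) :=
  (InnerProductSpace.toDual ℝ E).symm.contDiff.comp (hu.fderiv_right le_rfl)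

theorem hasCompactSupport_gradient {u : E → ℝ} (hu : HasCompactSupport u) :
    HasCompactSupport (gradient u) :=
  (hu.fderiv ℝ).comp_left (g := (InnerProductSpace.toDual ℝ E).symm) (map_zero _)

theorem inner_gradient_eq {u : E → ℝ} (g v : E) : ⟪gradient u g, v⟫_ℝ = fderiv ℝ u g v := by
  rw [gradient, InnerProductSpace.toDual_symm_apply]

theorem ContDiff.continuous_jet {u : E → ℝ} (hu : ContDiff ℝ 2 u) : Continuous (jet u) :=
  have h : ContDiff ℝ 1 (gradient u) := contDiff_gradient hu
  hu.continuous.prodMk (h.continuous.prodMk (h.continuous_fderiv one_ne_zero))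

theorem jet_congr {u v : E → ℝ} {g : E} (h : u =ᶠ[𝓝 g] v) : jet u g = jet v g := by
  have h1 : gradient u =ᶠ[𝓝 g] gradient v :=
    h.fderiv.mono fun x hx => congrArg (InnerProductSpace.toDual ℝ E).symm hx
  simp [jet, h.eq_of_nhds, h1.eq_of_nhds, h1.fderiv_eq]

variable [MeasurableSpace E] [BorelSpace E]

theorem integral_fderiv_apply_eq_zero {f : E → ℝ} (hf : ContDiff ℝ 1 f) (hc : HasCompactSupport f)
    (v : E) : ∫ g, fderiv ℝ f g v = 0 := by
  have h := integral_mul_fderiv_eq_neg_fderiv_mul_of_integrable (μ := (volume : Measure E))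
    (f := fun _ => (1 : ℝ)) (g := f) (v := v) (by simp)
    (by
      simp only [one_mul]
      exact ((hf.continuous_fderiv one_ne_zero).clm_apply continuous_const).integrable_of_hasCompactSupport
        (hc.fderiv_apply ℝ v))
    (by simpa using hf.continuous.integrable_of_hasCompactSupport hc)
    (fun _ _ => by fun_prop) (fun x _ => hf.differentiable one_ne_zero x)
  simpa using h

theorem integral_euclDiv_eq_zero {F : E → E} (hF : ContDiff ℝ 1 F) (hc : HasCompactSupport F) :
    ∫ g, euclDiv F g = 0 := by
  have hd : Differentiable ℝ F := hF.differentiable one_ne_zero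
  have key : ∀ a g, ⟪stdOrthonormalBasis ℝ E a, fderiv ℝ F g (stdOrthonormalBasis ℝ E a)⟫_ℝ
      = fderiv ℝ (fun x => ⟪stdOrthonormalBasis ℝ E a, F x⟫_ℝ) g (stdOrthonormalBasis ℝ E a) := by
    intro a g
    rw [fderiv_inner_apply ℝ (differentiableAt_const _) (hd g)]
    simp
  have hs : ∀ a, ContDiff ℝ 1 (fun x => ⟪stdOrthonormalBasis ℝ E a, F x⟫_ℝ) :=
    fun a => contDiff_const.inner ℝ hF
  have hcs : ∀ a, HasCompactSupport (fun x => ⟪stdOrthonormalBasis ℝ E a, F x⟫_ℝ) :=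
    fun a => hc.comp_left (g := fun y => ⟪stdOrthonormalBasis ℝ E a, y⟫_ℝ) (inner_zero_right _)
  simp only [euclDiv_eq_sum, key]
  rw [integral_finsetSum]
  · exact Finset.sum_eq_zero fun a _ => integral_fderiv_apply_eq_zero (hs a) (hcs a) _
  · intro a _
    exact (((hs a).continuous_fderiv one_ne_zero).clm_apply
      continuous_const).integrable_of_hasCompactSupport ((hcs a).fderiv_apply ℝ _)

theorem integral_mul_euclDiv {F : E → E} (hF : ContDiff ℝ 1 F) {χ : E → ℝ} (hχ : ContDiff ℝ 1 χ)
    (hc : HasCompactSupport χ) : ∫ g, (χ g * euclDiv F g + fderiv ℝ χ g (F g)) = 0 := by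
  rw [← integral_euclDiv_eq_zero (hχ.smul hF) hc.smul_right]
  congr 1
  ext g
  exact (euclDiv_smul (hχ.differentiable one_ne_zero g) (hF.differentiable one_ne_zero g)).symm

/-! ### Approximation of second-order jets -/

theorem fderiv_normed_convolution {F : Type*} [NormedAddCommGroup F] [NormedSpace ℝ F]
    [CompleteSpace F] (ρ : ContDiffBump (0 : E)) {w : E → F}
    (hw : ContDiff ℝ 1 w) (hc : HasCompactSupport w) :
    fderiv ℝ (convolution (ρ.normed volume) w (ContinuousLinearMap.lsmul ℝ ℝ) volume)
      = convolution (ρ.normed volume) (fderiv ℝ w) (ContinuousLinearMap.lsmul ℝ ℝ) volume := by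
  ext1 g
  have hρ : LocallyIntegrable (ρ.normed (volume : Measure E)) volume :=
    ρ.continuous_normed.locallyIntegrable
  exact (hc.hasFDerivAt_convolution_right (ContinuousLinearMap.lsmul ℝ ℝ) hρ hw g).fderiv

theorem gradient_normed_convolution (ρ : ContDiffBump (0 : E)) {w : E → ℝ}
    (hw : ContDiff ℝ 1 w) (hc : HasCompactSupport w) :
    gradient (convolution (ρ.normed volume) w (ContinuousLinearMap.lsmul ℝ ℝ) volume)
      = convolution (ρ.normed volume) (gradient w) (ContinuousLinearMap.lsmul ℝ ℝ) volume := by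
  ext1 g
  rw [gradient, fderiv_normed_convolution ρ hw hc]
  exact ((InnerProductSpace.toDual ℝ E).symm.toContinuousLinearEquiv.toContinuousLinearMap.integral_comp_comm
    (φ := fun t => ρ.normed volume t • fderiv ℝ w (g - t)) (by
      refine Continuous.integrable_of_hasCompactSupport ?_ ρ.hasCompactSupport_normed.smul_right
      exact ρ.continuous_normed.smul ((hw.continuous_fderiv one_ne_zero).comp
        (continuous_const.sub continuous_id)))).symm.trans (by simp [convolution, gradient])

/-- Compactly supported `C²` functions are uniform limits of smooth ones, together with their
derivatives of order at most two. -/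
theorem exists_contDiff_dist_le {w : E → ℝ} (hw : ContDiff ℝ 2 w) (hc : HasCompactSupport w)
    {ε : ℝ} (hε : 0 < ε) :
    ∃ v : E → ℝ, ContDiff ℝ (⊤ : ℕ∞) v ∧ ∀ g, dist (v g) (w g) ≤ ε ∧
      dist (gradient v g) (gradient w g) ≤ ε ∧
      dist (fderiv ℝ (gradient v) g) (fderiv ℝ (gradient w) g) ≤ ε := by
  have hw1 : ContDiff ℝ 1 (gradient w) := contDiff_gradient hw
  have hw2 := hw1.continuous_fderiv one_ne_zero
  obtain ⟨δ₀, hδ₀, h₀⟩ := Metric.uniformContinuous_iff.1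
    (hc.uniformContinuous_of_continuous hw.continuous) ε hε
  obtain ⟨δ₁, hδ₁, h₁⟩ := Metric.uniformContinuous_iff.1
    ((hasCompactSupport_gradient hc).uniformContinuous_of_continuous hw1.continuous) ε hε
  obtain ⟨δ₂, hδ₂, h₂⟩ := Metric.uniformContinuous_iff.1
    (((hasCompactSupport_gradient hc).fderiv ℝ).uniformContinuous_of_continuous hw2) ε hε
  obtain ⟨δ, hδ, hδm⟩ : ∃ δ > 0, δ ≤ δ₀ ∧ δ ≤ δ₁ ∧ δ ≤ δ₂ :=
    ⟨min δ₀ (min δ₁ δ₂), by positivity, by simp⟩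
  let ρ : ContDiffBump (0 : E) := ⟨δ / 2, δ, half_pos hδ, half_lt_self hδ⟩
  refine ⟨convolution (ρ.normed volume) w (ContinuousLinearMap.lsmul ℝ ℝ) volume,
    ρ.hasCompactSupport_normed.contDiff_convolution_left _ ρ.contDiff_normed
      hw.continuous.locallyIntegrable, fun g => ?_⟩
  rw [gradient_normed_convolution ρ (hw.of_le (by norm_num)) hc,
    fderiv_normed_convolution ρ hw1 (hasCompactSupport_gradient hc)]
  refine ⟨?_, ?_, ?_⟩
  · exact ρ.dist_normed_convolution_le hw.continuous.aestronglyMeasurable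
      fun x hx => (h₀ ((Metric.mem_ball.1 hx).trans_le hδm.1)).le
  · exact ρ.dist_normed_convolution_le hw1.continuous.aestronglyMeasurable
      fun x hx => (h₁ ((Metric.mem_ball.1 hx).trans_le hδm.2.1)).le
  · exact ρ.dist_normed_convolution_le hw2.aestronglyMeasurable
      fun x hx => (h₂ ((Metric.mem_ball.1 hx).trans_le hδm.2.2)).le

/-- A bump function equal to 1 on a neighbourhood of K and supported in Ω localizes u, so that it
can be mollified on the whole space. Agreement near each point of K, not just on K, is what keeps
the second-order jets equal there. -/
theorem exists_contDiff_hasCompactSupport_eventuallyEq {Ω K : Set E} (hΩ : IsOpen Ω)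
    (hK : IsCompact K) (hKΩ : K ⊆ Ω) {u : E → ℝ} (hu : ContDiffOn ℝ 2 u Ω) :
    ∃ w : E → ℝ, ContDiff ℝ 2 w ∧ HasCompactSupport w ∧ ∀ g ∈ K, w =ᶠ[𝓝 g] u := by
  obtain ⟨K', hK', hKK', hK'Ω⟩ := exists_compact_between hK hΩ hKΩ
  obtain ⟨L, hL, hK'L, hLΩ⟩ := exists_compact_between hK' hΩ hK'Ω
  obtain ⟨ζ, hζ, -, hζ0, hζ1⟩ := exists_contMDiff_zero_iff_one_iff_of_isClosed
    (modelWithCornersSelf ℝ E) (n := 2) (isOpen_interior (s := L)).isClosed_compl hK'.isClosed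
    (Set.disjoint_compl_left_iff_subset.2 hK'L)
  rw [contMDiff_iff_contDiff] at hζ
  have hts : tsupport ζ ⊆ L := closure_minimal
    (fun x hx => interior_subset (not_not.1 fun h => hx ((hζ0 x).1 h))) hL.isClosed
  have hζc : HasCompactSupport ζ := hL.of_isClosed_subset (isClosed_tsupport _) hts
  refine ⟨fun g => ζ g * u g, contDiff_iff_contDiffAt.2 fun x => ?_, hζc.mul_right, fun g hg => ?_⟩
  · by_cases hx : x ∈ tsupport ζ
    · exact hζ.contDiffAt.mul (hu.contDiffAt (hΩ.mem_nhds (hLΩ (hts hx))))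
    · refine (contDiffAt_const (c := (0 : ℝ))).congr_of_eventuallyEq ?_
      filter_upwards [notMem_tsupport_iff_eventuallyEq.1 hx] with y hy
      simp [hy]
  · filter_upwards [mem_interior_iff_mem_nhds.1 (hKK' hg)] with x hx
    rw [(hζ1 x).1 hx, one_mul]

/-- Passage to the limit in integrals of a continuous function supported over a compact set. -/
theorem tendsto_integral_comp {F : Type*} [TopologicalSpace F] {K : Set E} {L : Set F}
    (hK : IsCompact K) (hL : IsCompact L)
    {Φ : E × F → ℝ} (hΦ : Continuous Φ) (hΦK : ∀ g ∉ K, ∀ J, Φ (g, J) = 0)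
    {j : E → F} {jn : ℕ → E → F} (hjn : ∀ n, Continuous (jn n))
    (hjL : ∀ n, ∀ g ∈ K, jn n g ∈ L)
    (hlim : ∀ g, Filter.Tendsto (fun n => jn n g) Filter.atTop (𝓝 (j g))) :
    Filter.Tendsto (fun n => ∫ g, Φ (g, jn n g)) Filter.atTop (𝓝 (∫ g, Φ (g, j g))) := by
  obtain ⟨B, hB⟩ := (hK.prod hL).exists_bound_of_continuousOn hΦ.continuousOn
  refine tendsto_integral_of_dominated_convergence (K.indicator fun _ => B)
    (fun n => (hΦ.comp (continuous_id.prodMk (hjn n))).aestronglyMeasurable)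
    ((integrable_indicator_iff hK.measurableSet).2 (integrableOn_const hK.measure_lt_top.ne))
    (fun n => Filter.Eventually.of_forall fun g => ?_)
    (Filter.Eventually.of_forall fun g =>
      (hΦ.tendsto _).comp (tendsto_const_nhds.prodMk_nhds (hlim g)))
  by_cases hg : g ∈ K
  · rw [Set.indicator_of_mem hg]
    exact hB _ ⟨hg, hjL n g hg⟩
  · simp [hΦK g hg, hg]

theorem HasCompactSupport.exists_closedBall {F : Type*} [NormedAddCommGroup F]
    {w : E → F} (hw : Continuous w) (hc : HasCompactSupport w) {vn : ℕ → E → F}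
    (h : ∀ n g, dist (vn n g) (w g) ≤ 1 / ((n : ℝ) + 1)) :
    ∃ R, ∀ n g, vn n g ∈ Metric.closedBall 0 R := by
  obtain ⟨C, hC⟩ := hw.bounded_above_of_compact_support hc
  refine ⟨1 + C, fun n g => Metric.mem_closedBall.2 ((dist_triangle _ (w g) _).trans ?_)⟩
  refine add_le_add ((h n g).trans ?_) (by simpa using hC g)
  rw [div_le_one (by positivity)]
  linarith [n.cast_nonneg (α := ℝ)]

theorem tendsto_of_dist_le_one_div {F : Type*} [PseudoMetricSpace F] {y : F} {x : ℕ → F}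
    (h : ∀ n, dist (x n) y ≤ 1 / ((n : ℝ) + 1)) : Filter.Tendsto x Filter.atTop (𝓝 y) :=
  tendsto_iff_dist_tendsto_zero.2
    (squeeze_zero (fun _ => dist_nonneg) h tendsto_one_div_add_atTop_nhds_zero_nat)

/-- An integral identity that holds for smooth functions and involves only their second-order jets
extends to `C²` functions. -/
theorem integral_jet_eq_zero {Ω K : Set E} (hΩ : IsOpen Ω) (hK : IsCompact K) (hKΩ : K ⊆ Ω)
    {Φ : E × Jet E → ℝ} (hΦ : Continuous Φ) (hΦK : ∀ g ∉ K, ∀ J, Φ (g, J) = 0)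
    (h0 : ∀ v : E → ℝ, ContDiff ℝ (⊤ : ℕ∞) v → ∫ g, Φ (g, jet v g) = 0)
    {u : E → ℝ} (hu : ContDiffOn ℝ 2 u Ω) : ∫ g, Φ (g, jet u g) = 0 := by
  -- The jets of the mollifications of w converge uniformly and stay in one compact set, so
  -- dominated convergence carries the identity to w. Over K the jets of w and u coincide, and off K
  -- the integrand vanishes for any jet.
  obtain ⟨w, hw, hc, hwu⟩ := exists_contDiff_hasCompactSupport_eventuallyEq hΩ hK hKΩ hu
  have happ : ∀ n : ℕ, ∃ v : E → ℝ, ContDiff ℝ (⊤ : ℕ∞) v ∧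
      ∀ g, dist (v g) (w g) ≤ 1 / ((n : ℝ) + 1) ∧
      dist (gradient v g) (gradient w g) ≤ 1 / ((n : ℝ) + 1) ∧
      dist (fderiv ℝ (gradient v) g) (fderiv ℝ (gradient w) g) ≤ 1 / ((n : ℝ) + 1) :=
    fun n => exists_contDiff_dist_le hw hc Nat.one_div_pos_of_nat
  choose v hv hvw using happ
  have hw1 : ContDiff ℝ 1 (gradient w) := contDiff_gradient hw
  obtain ⟨R₀, hR₀⟩ := hc.exists_closedBall hw.continuous fun n g => (hvw n g).1
  obtain ⟨R₁, hR₁⟩ := (hasCompactSupport_gradient hc).exists_closedBall hw1.continuous fun n g => (hvw n g).2.1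
  obtain ⟨R₂, hR₂⟩ := ((hasCompactSupport_gradient hc).fderiv ℝ).exists_closedBall
    (hw1.continuous_fderiv one_ne_zero) fun n g => (hvw n g).2.2
  have hp₁ := FiniteDimensional.proper_real E
  have hp₂ := FiniteDimensional.proper_real (E →L[ℝ] E)
  have hlim := tendsto_integral_comp hK
    ((isCompact_closedBall 0 R₀).prod ((isCompact_closedBall 0 R₁).prod
      (isCompact_closedBall 0 R₂))) hΦ hΦK (j := jet w) (jn := fun n => jet (v n))
    (fun n => (contDiff_infty.1 (hv n) 2).continuous_jet)
    (fun n g _ => ⟨hR₀ n g, hR₁ n g, hR₂ n g⟩)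
    (fun g => (tendsto_of_dist_le_one_div fun n => (hvw n g).1).prodMk_nhds
      ((tendsto_of_dist_le_one_div fun n => (hvw n g).2.1).prodMk_nhds
        (tendsto_of_dist_le_one_div fun n => (hvw n g).2.2)))
  simp only [h0 _ (hv _)] at hlim
  rw [← tendsto_nhds_unique hlim tendsto_const_nhds]
  refine integral_congr_ae (Filter.Eventually.of_forall fun g => ?_)
  by_cases hg : g ∈ K
  · change Φ (g, jet u g) = Φ (g, jet w g)
    rw [jet_congr (hwu g hg)]
  · exact (hΦK g hg _).trans (hΦK g hg _).symm

end Calculus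

/-! ### Divergence theorem by cutoffs in the level sets of the defining function -/

section Domain

variable {E : Type*} [NormedAddCommGroup E] [InnerProductSpace ℝ E] [FiniteDimensional ℝ E]

/-- A cutoff function which vanishes where `-ε ≤ φ` and equals `1` where `φ ≤ -2 ε`. -/
def cutoff (φ : E → ℝ) (ε : ℝ) (g : E) : ℝ := Real.smoothTransition (-φ g / ε - 1)

/-- The density of `-d (cutoff φ ε)` with respect to `dφ`. -/
def cutoffWeight (φ : E → ℝ) (ε : ℝ) (g : E) : ℝ :=
  deriv Real.smoothTransition (-φ g / ε - 1) / ε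

theorem contDiff_cutoff {φ : E → ℝ} {n : ℕ∞} (hφ : ContDiff ℝ n φ) (ε : ℝ) :
    ContDiff ℝ n (cutoff φ ε) :=
  Real.smoothTransition.contDiff.comp ((hφ.neg.div_const ε).sub contDiff_const)

theorem fderiv_cutoff {φ : E → ℝ} {g : E} (hφ : DifferentiableAt ℝ φ g) (ε : ℝ) (v : E) :
    fderiv ℝ (cutoff φ ε) g v = -(cutoffWeight φ ε g * fderiv ℝ φ g v) := by
  have h1 : HasFDerivAt (fun x => -φ x / ε - 1) (ε⁻¹ • -fderiv ℝ φ g) g := by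
    have := (hφ.hasFDerivAt.neg.const_mul ε⁻¹).sub_const 1
    simpa [div_eq_inv_mul] using this
  have h2 : HasDerivAt Real.smoothTransition
      (deriv Real.smoothTransition (-φ g / ε - 1)) (-φ g / ε - 1) :=
    ((Real.smoothTransition.contDiff (n := 1)).differentiable one_ne_zero _).hasDerivAt
  have h3 := (h2.comp_hasFDerivAt g h1).fderiv
  rw [show cutoff φ ε = Real.smoothTransition ∘ fun x => -φ x / ε - 1 from rfl, h3]
  simp only [smul_apply, neg_apply, smul_eq_mul,
    cutoffWeight]
  ring

theorem cutoff_nonneg (φ : E → ℝ) (ε : ℝ) (g : E) : 0 ≤ cutoff φ ε g :=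
  Real.smoothTransition.nonneg _

theorem cutoff_le_one (φ : E → ℝ) (ε : ℝ) (g : E) : cutoff φ ε g ≤ 1 :=
  Real.smoothTransition.le_one _

theorem cutoff_eq_zero {φ : E → ℝ} {ε : ℝ} (hε : 0 < ε) {g : E} (h : -ε ≤ φ g) :
    cutoff φ ε g = 0 := by
  refine Real.smoothTransition.zero_of_nonpos ?_
  rw [sub_nonpos, div_le_one hε]
  linarith

theorem cutoff_eq_one {φ : E → ℝ} {ε : ℝ} (hε : 0 < ε) {g : E} (h : φ g ≤ -(2 * ε)) :
    cutoff φ ε g = 1 := by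
  refine Real.smoothTransition.one_of_one_le ?_
  rw [le_sub_iff_add_le, le_div_iff₀ hε]
  linarith

theorem cutoffWeight_nonneg (φ : E → ℝ) {ε : ℝ} (hε : 0 < ε) (g : E) : 0 ≤ cutoffWeight φ ε g :=
  div_nonneg (Real.smoothTransition.monotone.deriv_nonneg) hε.le

theorem continuous_cutoffWeight {φ : E → ℝ} (hφ : Continuous φ) (ε : ℝ) :
    Continuous (cutoffWeight φ ε) :=
  (((Real.smoothTransition.contDiff (n := 1)).continuous_deriv le_rfl).comp
    ((hφ.neg.div_const ε).sub continuous_const)).div_const ε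

theorem cutoffWeight_eq_zero {φ : E → ℝ} {ε : ℝ} (hε : 0 < ε) {g : E}
    (h : -ε < φ g ∨ φ g < -(2 * ε)) : cutoffWeight φ ε g = 0 := by
  rw [cutoffWeight, div_eq_zero_iff]
  left
  rcases h with h | h
  · have h0 : Real.smoothTransition =ᶠ[𝓝 (-φ g / ε - 1)] fun _ => 0 := by
      have : -φ g / ε - 1 < 0 := by
        rw [sub_neg, div_lt_one hε]
        linarith
      filter_upwards [Iio_mem_nhds this] with x hx
      exact Real.smoothTransition.zero_of_nonpos (le_of_lt hx)
    rw [h0.deriv_eq, deriv_const]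
  · have h0 : Real.smoothTransition =ᶠ[𝓝 (-φ g / ε - 1)] fun _ => 1 := by
      have : 1 < -φ g / ε - 1 := by
        rw [lt_sub_iff_add_lt, lt_div_iff₀ hε]
        linarith
      filter_upwards [Ioi_mem_nhds this] with x hx
      exact Real.smoothTransition.one_of_one_le (le_of_lt hx)
    rw [h0.deriv_eq, deriv_const]

namespace IsDefiningFunction

variable {φ : E → ℝ} {Ω : Set E}

theorem isOpen (hφ : IsDefiningFunction φ Ω) : IsOpen Ω :=
  hφ.eq_setOf ▸ isOpen_lt hφ.contDiff.continuous continuous_const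

theorem mem_iff (hφ : IsDefiningFunction φ Ω) {g : E} : g ∈ Ω ↔ φ g < 0 := by
  rw [hφ.eq_setOf]; rfl

theorem isCompact_sublevel (hφ : IsDefiningFunction φ Ω) (hb : Bornology.IsBounded Ω)
    {ε : ℝ} (hε : 0 < ε) : IsCompact {g | φ g ≤ -ε} := by
  have := FiniteDimensional.proper_real E
  refine Metric.isCompact_of_isClosed_isBounded
    (isClosed_le hφ.contDiff.continuous continuous_const) (hb.subset fun g hg => ?_)
  rw [hφ.mem_iff]
  exact lt_of_le_of_lt hg (by linarith)

theorem isCompact_closure (hb : Bornology.IsBounded Ω) : IsCompact (closure Ω) :=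
  have := FiniteDimensional.proper_real E
  hb.isCompact_closure

theorem eq_zero_of_mem_frontier (hφ : IsDefiningFunction φ Ω) {g : E} (hg : g ∈ frontier Ω) :
    φ g = 0 := by
  rw [hφ.isOpen.frontier_eq, Set.mem_sdiff, hφ.mem_iff, not_lt] at hg
  refine le_antisymm ?_ hg.2
  have : closure Ω ⊆ {g | φ g ≤ 0} := closure_minimal (fun x hx => (hφ.mem_iff.1 hx).le)
    (isClosed_le hφ.contDiff.continuous continuous_const)
  exact this hg.1

/-- A function continuous on the closure of the domain and negative on its boundary is negative in
a neighbourhood of the boundary. -/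
theorem exists_neg_of_frontier (hφ : IsDefiningFunction φ Ω) (hb : Bornology.IsBounded Ω)
    {f : E → ℝ} (hf : ContinuousOn f (closure Ω)) (hneg : ∀ g ∈ frontier Ω, f g < 0) :
    ∃ δ > 0, ∀ g ∈ Ω, -δ < φ g → f g < 0 := by
  have hN : IsCompact (closure Ω ∩ f ⁻¹' Set.Ici 0) :=
    (isCompact_closure hb).of_isClosed_subset
      (hf.preimage_isClosed_of_isClosed isClosed_closure isClosed_Ici) Set.inter_subset_left
  have hNΩ : ∀ g ∈ closure Ω ∩ f ⁻¹' Set.Ici 0, φ g < 0 := by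
    rintro g ⟨hg, hfg⟩
    by_contra h
    have : g ∈ frontier Ω := by
      rw [hφ.isOpen.frontier_eq]
      exact ⟨hg, fun h' => h (hφ.mem_iff.1 h')⟩
    exact absurd (hneg g this) (not_lt.2 hfg)
  rcases (closure Ω ∩ f ⁻¹' Set.Ici 0).eq_empty_or_nonempty with h0 | hne
  · refine ⟨1, one_pos, fun g hg _ => ?_⟩
    by_contra h
    exact (Set.eq_empty_iff_forall_notMem.1 h0 g) ⟨subset_closure hg, not_lt.1 h⟩
  · obtain ⟨g₀, hg₀, hmax⟩ := hN.exists_isMaxOn hne hφ.contDiff.continuous.continuousOn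
    refine ⟨-φ g₀, neg_pos.2 (hNΩ g₀ hg₀), fun g hg hgφ => ?_⟩
    by_contra h
    have := hmax ⟨subset_closure hg, not_lt.1 h⟩
    simp only [Set.mem_ofPred_eq] at this
    linarith

end IsDefiningFunction

variable [MeasurableSpace E] [BorelSpace E]

/-- `F` is a vector field depending continuously on the second-order jet of a function, and its
divergence along the jet of a smooth function is `d`. -/
structure IsDivergence (d : E × Jet E → ℝ) (F : E × Jet E → E) : Prop where
  continuous_div : Continuous d
  continuous_field : Continuous F
  contDiff : ∀ v : E → ℝ, ContDiff ℝ (⊤ : ℕ∞) v → ContDiff ℝ 1 fun g => F (g, jet v g)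
  euclDiv_eq : ∀ v : E → ℝ, ContDiff ℝ (⊤ : ℕ∞) v → ∀ g,
    euclDiv (fun x => F (x, jet v x)) g = d (g, jet v g)

namespace IsDefiningFunction

variable {φ : E → ℝ} {Ω : Set E}

theorem integrableOn (hb : Bornology.IsBounded Ω) {f : E → ℝ} (hf : ContinuousOn f (closure Ω)) :
    IntegrableOn f Ω :=
  (hf.integrableOn_compact (isCompact_closure hb)).mono_set subset_closure

/-- The cutoff lives on a compact sublevel set inside Ω, where u is C², so the integrated divergence
identity of smooth functions passes to u. The weight term is the flux smeared over a thin layer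
along the boundary. -/
theorem setIntegral_cutoff_mul_eq (hφ : IsDefiningFunction φ Ω) (hb : Bornology.IsBounded Ω)
    {d : E × Jet E → ℝ} {F : E × Jet E → E} (hF : IsDivergence d F) {u : E → ℝ}
    (hu : ContDiffOn ℝ 2 u Ω) {ε : ℝ} (hε : 0 < ε) :
    ∫ g in Ω, (cutoff φ ε g * d (g, jet u g)
      - cutoffWeight φ ε g * fderiv ℝ φ g (F (g, jet u g))) = 0 := by
  have hφc := hφ.contDiff.continuous
  have hφ1 : ContDiff ℝ 1 φ := hφ.contDiff.of_le (by norm_num)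
  have hd := hF.continuous_div
  have hFc := hF.continuous_field
  have hc : Continuous (cutoff φ ε) := (contDiff_cutoff (n := 1) hφ1 ε).continuous
  have hk := continuous_cutoffWeight hφc ε
  have hφd := hφ1.continuous_fderiv one_ne_zero
  have hKΩ : {g | φ g ≤ -ε} ⊆ Ω := fun g hg => hφ.mem_iff.2 (lt_of_le_of_lt hg (by linarith))
  have hzero : ∀ g ∉ {g | φ g ≤ -ε}, ∀ J : Jet E, cutoff φ ε g * d (g, J)
      - cutoffWeight φ ε g * fderiv ℝ φ g (F (g, J)) = 0 := by
    intro g hg J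
    rw [Set.mem_ofPred_eq, not_le] at hg
    rw [cutoff_eq_zero hε hg.le, cutoffWeight_eq_zero hε (Or.inl hg)]
    ring
  rw [setIntegral_eq_integral_of_forall_compl_eq_zero
    fun g hg => hzero g (fun h => hg (hKΩ h)) _]
  refine integral_jet_eq_zero (K := {g | φ g ≤ -ε}) (Φ := fun p => cutoff φ ε p.1 * d p
    - cutoffWeight φ ε p.1 * fderiv ℝ φ p.1 (F p)) hφ.isOpen (hφ.isCompact_sublevel hb hε) hKΩ
    ?_ hzero (fun v hv => ?_) hu
  · exact ((hc.comp continuous_fst).mul hd).sub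
      ((hk.comp continuous_fst).mul ((hφd.comp continuous_fst).clm_apply hFc))
  · rw [← integral_mul_euclDiv (hF.contDiff v hv) (contDiff_cutoff (n := 1) hφ1 ε)
      (HasCompactSupport.intro (hφ.isCompact_sublevel hb hε) fun g hg =>
        cutoff_eq_zero hε (le_of_not_ge hg))]
    congr 1
    ext g
    rw [hF.euclDiv_eq v hv, fderiv_cutoff (hφ1.differentiable one_ne_zero g)]
    ring

theorem contDiff_gradient (hφ : IsDefiningFunction φ Ω) : ContDiff ℝ 1 (gradient φ) :=
  _root_.contDiff_gradient hφ.contDiff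

/-- The same cutoff identity applied to the C¹ field ∇φ expresses the layer mass as an integral of
its divergence against the cutoff. The bound is independent of ε, and takes the place of finiteness
of the surface measure. -/
theorem setIntegral_cutoffWeight_mul_le (hφ : IsDefiningFunction φ Ω)
    (hb : Bornology.IsBounded Ω) {ε : ℝ} (hε : 0 < ε) :
    ∫ g in Ω, cutoffWeight φ ε g * fderiv ℝ φ g (gradient φ g)
      ≤ ∫ g in Ω, |euclDiv (gradient φ) g| := by
  have hφ1 : ContDiff ℝ 1 φ := hφ.contDiff.of_le (by norm_num)
  have hφd := hφ1.continuous_fderiv one_ne_zero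
  have hg := hφ.contDiff_gradient
  have hc : Continuous (cutoff φ ε) := (contDiff_cutoff (n := 1) hφ1 ε).continuous
  have hk := continuous_cutoffWeight hφ.contDiff.continuous ε
  have hdiv := continuous_euclDiv hg
  have h0 := integral_mul_euclDiv hg (contDiff_cutoff (n := 1) hφ1 ε)
    (HasCompactSupport.intro (hφ.isCompact_sublevel hb hε) fun g hg =>
      cutoff_eq_zero hε (le_of_not_ge hg))
  have hzero : ∀ g ∉ Ω, cutoff φ ε g * euclDiv (gradient φ) g
      + fderiv ℝ (cutoff φ ε) g (gradient φ g) = 0 := by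
    intro g hg
    have hg' : -ε < φ g := by
      rw [hφ.mem_iff, not_lt] at hg
      linarith
    rw [cutoff_eq_zero hε hg'.le, fderiv_cutoff (hφ1.differentiable one_ne_zero g),
      cutoffWeight_eq_zero hε (Or.inl hg')]
    ring
  rw [← setIntegral_eq_integral_of_forall_compl_eq_zero hzero] at h0
  have i1 : IntegrableOn (fun g => cutoff φ ε g * euclDiv (gradient φ) g) Ω :=
    integrableOn hb (hc.mul hdiv).continuousOn
  have i2 : IntegrableOn (fun g => cutoffWeight φ ε g * fderiv ℝ φ g (gradient φ g)) Ω :=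
    integrableOn hb (hk.mul (hφd.clm_apply hg.continuous)).continuousOn
  have i3 : IntegrableOn (fun g => |euclDiv (gradient φ) g|) Ω :=
    integrableOn hb hdiv.abs.continuousOn
  simp only [fderiv_cutoff (hφ1.differentiable one_ne_zero _), ← sub_eq_add_neg] at h0
  rw [integral_sub i1 i2, sub_eq_zero] at h0
  rw [← h0]
  refine setIntegral_mono i1 i3 fun g => ?_
  calc cutoff φ ε g * euclDiv (gradient φ) g ≤ cutoff φ ε g * |euclDiv (gradient φ) g| :=
        mul_le_mul_of_nonneg_left (le_abs_self _) (cutoff_nonneg _ _ _)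
    _ ≤ 1 * |euclDiv (gradient φ) g| :=
        mul_le_mul_of_nonneg_right (cutoff_le_one _ _ _) (abs_nonneg _)
    _ = _ := one_mul _

/-- The divergence theorem on a `C²` domain, in the form of an inequality: if the field points
inwards along the boundary, the integral of its divergence is nonpositive. -/
theorem setIntegral_div_nonpos (hφ : IsDefiningFunction φ Ω) (hb : Bornology.IsBounded Ω)
    {d : E × Jet E → ℝ} {F : E × Jet E → E} (hF : IsDivergence d F) {u : E → ℝ}
    (hu : ContDiffOn ℝ 2 u Ω) {j : E → Jet E} (hj : ContinuousOn j (closure Ω))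
    (hju : ∀ g ∈ Ω, j g = jet u g)
    (hbd : ∀ g ∈ frontier Ω, fderiv ℝ φ g (F (g, j g)) ≤ 0) :
    ∫ g in Ω, d (g, j g) ≤ 0 := by
  have hφ1 : ContDiff ℝ 1 φ := hφ.contDiff.of_le (by norm_num)
  have hφd := hφ1.continuous_fderiv one_ne_zero
  have hm : MeasurableSet Ω := hφ.isOpen.measurableSet
  have hdc : ContinuousOn (fun g => d (g, j g)) (closure Ω) :=
    hF.continuous_div.comp_continuousOn (continuousOn_id.prodMk hj)
  have hfc : ContinuousOn (fun g => fderiv ℝ φ g (F (g, j g))) (closure Ω) :=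
    hφd.continuousOn.clm_apply (hF.continuous_field.comp_continuousOn (continuousOn_id.prodMk hj))
  have hc : ∀ ε, Continuous (cutoff φ ε) :=
    fun ε => (contDiff_cutoff (n := 1) hφ1 ε).continuous
  have hk := continuous_cutoffWeight hφ.contDiff.continuous
  have hε : ∀ n : ℕ, (0 : ℝ) < 1 / ((n : ℝ) + 1) := fun n => Nat.one_div_pos_of_nat
  have heq : ∀ n : ℕ, ∫ g in Ω, cutoff φ (1 / ((n : ℝ) + 1)) g * d (g, j g)
      = ∫ g in Ω, cutoffWeight φ (1 / ((n : ℝ) + 1)) g * fderiv ℝ φ g (F (g, j g)) := by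
    intro n
    have i1 : IntegrableOn (fun g => cutoff φ (1 / ((n : ℝ) + 1)) g * d (g, j g)) Ω :=
      integrableOn hb ((hc _).continuousOn.mul hdc)
    have i2 : IntegrableOn (fun g => cutoffWeight φ (1 / ((n : ℝ) + 1)) g
        * fderiv ℝ φ g (F (g, j g))) Ω := integrableOn hb ((hk _).continuousOn.mul hfc)
    rw [← sub_eq_zero, ← integral_sub i1 i2, ← hφ.setIntegral_cutoff_mul_eq hb hF hu (hε n)]
    exact setIntegral_congr_fun hm fun g hg => by simp only [hju g hg]
  have hlim : Filter.Tendsto (fun n : ℕ => ∫ g in Ω, cutoff φ (1 / ((n : ℝ) + 1)) g * d (g, j g))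
      Filter.atTop (𝓝 (∫ g in Ω, d (g, j g))) := by
    refine tendsto_integral_of_dominated_convergence (fun g => |d (g, j g)|)
      (fun n => (integrableOn hb ((hc _).continuousOn.mul hdc)).aestronglyMeasurable)
      (integrableOn hb hdc).abs (fun n => Filter.Eventually.of_forall fun g => ?_)
      ((ae_restrict_iff' hm).2 (Filter.Eventually.of_forall fun g hg => ?_))
    · rw [Real.norm_eq_abs, abs_mul, abs_of_nonneg (cutoff_nonneg _ _ _)]
      exact mul_le_of_le_one_left (abs_nonneg _) (cutoff_le_one _ _ _)
    · have hg0 := hφ.mem_iff.1 hg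
      have h2 : ∀ᶠ n : ℕ in Filter.atTop, 1 / ((n : ℝ) + 1) < -φ g / 2 :=
        (tendsto_order.1 tendsto_one_div_add_atTop_nhds_zero_nat).2 _ (by linarith)
      refine tendsto_const_nhds.congr' ?_
      filter_upwards [h2] with n hn
      rw [cutoff_eq_one (hε n) (by linarith), one_mul]
  set B : ℝ := ∫ g in Ω, |euclDiv (gradient φ) g| with hB
  have hB0 : 0 ≤ B := integral_nonneg fun g => abs_nonneg _
  refine le_of_forall_pos_le_add fun η hη => ?_
  rw [zero_add]
  -- The flux is only assumed nonpositive on the boundary. Near it the flux density is at most t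
  -- |∇φ|², an error whose integral over the layer is at most t B ≤ η.
  set t : ℝ := η / (B + 1) with ht
  have ht0 : 0 < t := by positivity
  have hgg : Continuous fun g => fderiv ℝ φ g (gradient φ g) :=
    hφd.clm_apply hφ.contDiff_gradient.continuous
  obtain ⟨δ, hδ, hneg⟩ := hφ.exists_neg_of_frontier hb
    (f := fun g => fderiv ℝ φ g (F (g, j g)) - t * fderiv ℝ φ g (gradient φ g))
    (hfc.sub (continuous_const.mul hgg).continuousOn) (fun g hg => by
      have h1 : 0 < fderiv ℝ φ g (gradient φ g) := by
        rw [← inner_gradient_eq, real_inner_self_eq_norm_sq]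
        have : gradient φ g ≠ 0 := fun h => hφ.fderiv_ne_zero g hg <| by
          ext v
          rw [← inner_gradient_eq, h, inner_zero_left]
          rfl
        positivity
      have := mul_pos ht0 h1
      linarith [hbd g hg])
  -- The layer for ε is contained in -2ε ≤ φ ≤ -ε, so 2ε < δ places it where the strict inequality
  -- holds.
  have h2 : ∀ᶠ n : ℕ in Filter.atTop, 1 / ((n : ℝ) + 1) < δ / 2 :=
    (tendsto_order.1 tendsto_one_div_add_atTop_nhds_zero_nat).2 _ (by linarith)
  refine le_of_tendsto hlim ?_
  filter_upwards [h2] with n hn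
  rw [heq]
  calc ∫ g in Ω, cutoffWeight φ (1 / ((n : ℝ) + 1)) g * fderiv ℝ φ g (F (g, j g))
      ≤ ∫ g in Ω, t * (cutoffWeight φ (1 / ((n : ℝ) + 1)) g * fderiv ℝ φ g (gradient φ g)) := by
        refine setIntegral_mono_on (integrableOn hb ((hk _).continuousOn.mul hfc))
          (integrableOn hb (continuous_const.mul ((hk _).mul hgg)).continuousOn) hm fun g hg => ?_
        rcases lt_or_ge (φ g) (-(2 * (1 / ((n : ℝ) + 1)))) with h | h
        · rw [cutoffWeight_eq_zero (hε n) (Or.inr h), zero_mul, zero_mul, mul_zero]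
        · have := hneg g hg (by linarith)
          nlinarith [cutoffWeight_nonneg φ (hε n) g]
    _ ≤ t * B := by
        rw [integral_const_mul]
        exact mul_le_mul_of_nonneg_left (hφ.setIntegral_cutoffWeight_mul_le hb (hε n)) ht0.le
    _ ≤ η := by
        rw [ht, div_mul_eq_mul_div, div_le_iff₀ (by positivity)]
        nlinarith

end IsDefiningFunction

end Domain

/-! ### Boundary points, tangential derivatives and extension of jets -/

section Boundary

variable {E : Type*} [NormedAddCommGroup E] [InnerProductSpace ℝ E] [FiniteDimensional ℝ E]

namespace IsDefiningFunction

variable {φ : E → ℝ} {Ω : Set E}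

theorem differentiable (hφ : IsDefiningFunction φ Ω) : Differentiable ℝ φ :=
  hφ.contDiff.differentiable two_ne_zero

theorem eventually_neg (hφ : IsDefiningFunction φ Ω) {g v : E} (hg : φ g = 0)
    (hv : fderiv ℝ φ g v < 0) : ∀ᶠ s : ℝ in 𝓝[>] 0, φ (g + s • v) < 0 := by
  have h1 : HasDerivAt (fun s : ℝ => φ (g + s • v)) (fderiv ℝ φ g v) 0 := by
    have h2 : HasDerivAt (fun s : ℝ => g + s • v) v 0 := by
      simpa using ((hasDerivAt_id (0 : ℝ)).smul_const v).const_add g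
    have h3 : HasFDerivAt φ (fderiv ℝ φ g) (g + (0 : ℝ) • v) := by
      simpa using (hφ.differentiable g).hasFDerivAt
    exact h3.comp_hasDerivAt 0 h2
  have h4 := h1.tendsto_slope_zero_right
  simp only [zero_add, zero_smul, add_zero, hg, sub_zero, smul_eq_mul] at h4
  filter_upwards [(tendsto_order.1 h4).2 0 hv, self_mem_nhdsWithin] with s hs hs0
  have hs0' : 0 < s := hs0
  exact (mul_neg_iff.1 hs).elim (fun h => h.2) fun h => absurd h.1 (not_lt.2 (inv_pos.2 hs0').le)

theorem eventually_pos (hφ : IsDefiningFunction φ Ω) {g v : E} (hg : φ g = 0)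
    (hv : 0 < fderiv ℝ φ g v) : ∀ᶠ s : ℝ in 𝓝[>] 0, 0 < φ (g + s • v) := by
  have h1 : HasDerivAt (fun s : ℝ => φ (g + s • v)) (fderiv ℝ φ g v) 0 := by
    have h2 : HasDerivAt (fun s : ℝ => g + s • v) v 0 := by
      simpa using ((hasDerivAt_id (0 : ℝ)).smul_const v).const_add g
    have h3 : HasFDerivAt φ (fderiv ℝ φ g) (g + (0 : ℝ) • v) := by
      simpa using (hφ.differentiable g).hasFDerivAt
    exact h3.comp_hasDerivAt 0 h2
  have h4 := h1.tendsto_slope_zero_right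
  simp only [zero_add, zero_smul, add_zero, hg, sub_zero, smul_eq_mul] at h4
  filter_upwards [(tendsto_order.1 h4).1 0 hv, self_mem_nhdsWithin] with s hs hs0
  exact (pos_iff_pos_of_mul_pos hs).1 (inv_pos.2 hs0)

theorem gradient_ne_zero (hφ : IsDefiningFunction φ Ω) {g : E} (hg : g ∈ frontier Ω) :
    gradient φ g ≠ 0 := fun h => hφ.fderiv_ne_zero g hg <| by
  ext v
  rw [← inner_gradient_eq, h, inner_zero_left]
  rfl

theorem fderiv_gradient_pos (hφ : IsDefiningFunction φ Ω) {g : E} (hg : g ∈ frontier Ω) :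
    0 < fderiv ℝ φ g (gradient φ g) := by
  have := hφ.gradient_ne_zero hg
  rw [← inner_gradient_eq, real_inner_self_eq_norm_sq]
  positivity

theorem mem_frontier (hφ : IsDefiningFunction φ Ω) {g : E} (hg : φ g = 0)
    (hd : fderiv ℝ φ g ≠ 0) : g ∈ frontier Ω := by
  rw [hφ.isOpen.frontier_eq]
  refine ⟨?_, fun h => (hφ.mem_iff.1 h).ne hg⟩
  obtain ⟨v, hv⟩ : ∃ v, fderiv ℝ φ g v < 0 := by
    obtain ⟨w, hw⟩ : ∃ w, fderiv ℝ φ g w ≠ 0 := by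
      by_contra! h
      exact hd (ContinuousLinearMap.ext h)
    rcases lt_or_gt_of_ne hw with h | h
    · exact ⟨w, h⟩
    · exact ⟨-w, by simpa using h⟩
  have hlim : Filter.Tendsto (fun s : ℝ => g + s • v) (𝓝[>] 0) (𝓝 g) := by
    have : Continuous fun s : ℝ => g + s • v := by fun_prop
    simpa using (this.tendsto 0).mono_left nhdsWithin_le_nhds
  exact mem_closure_of_tendsto hlim ((hφ.eventually_neg hg hv).mono fun s hs => hφ.mem_iff.2 hs)

/-- At a boundary point the tangent cone contains the open half-space on which dφ is negative, and
this spans. It makes derivatives within the closure well defined and continuous up to the boundary.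
-/
theorem uniqueDiffOn_closure (hφ : IsDefiningFunction φ Ω) : UniqueDiffOn ℝ (closure Ω) := by
  intro g hg
  by_cases hgΩ : g ∈ Ω
  · exact uniqueDiffWithinAt_of_mem_nhds
      (Filter.mem_of_superset (hφ.isOpen.mem_nhds hgΩ) subset_closure)
  have hgf : g ∈ frontier Ω := by rw [hφ.isOpen.frontier_eq]; exact ⟨hg, hgΩ⟩
  refine ⟨?_, subset_closure hg⟩
  have hcone : ∀ v, fderiv ℝ φ g v < 0 → v ∈ tangentConeAt ℝ (closure Ω) g := by
    intro v hv
    refine mem_tangentConeAt_of_add_smul_mem (l := 𝓝[>] (0 : ℝ)) (c := id)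
      (nhdsWithin_mono 0 fun x hx => ne_of_gt hx)
      ((hφ.eventually_neg (hφ.eq_zero_of_mem_frontier hgf) hv).mono fun s hs =>
        subset_closure (hφ.mem_iff.2 hs))
  have htop : Submodule.span ℝ (tangentConeAt ℝ (closure Ω) g) = ⊤ := by
    rw [eq_top_iff]
    intro x _
    have hp := hφ.fderiv_gradient_pos hgf
    set N := gradient φ g
    -- With this K both x - K N and -K N lie in the half-space, and their difference is x.
    set K : ℝ := (|fderiv ℝ φ g x| + 1) / fderiv ℝ φ g N with hK
    have hK0 : 0 < K := by positivity
    have h1 : fderiv ℝ φ g (-(K • N)) < 0 := by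
      simp only [map_neg, map_smul, smul_eq_mul]
      have := mul_pos hK0 hp
      linarith
    have h2 : fderiv ℝ φ g (x + -(K • N)) < 0 := by
      simp only [map_neg, map_smul, smul_eq_mul, map_add]
      rw [hK, div_mul_cancel₀ _ hp.ne']
      linarith [le_abs_self (fderiv ℝ φ g x)]
    have := Submodule.sub_mem _ (Submodule.subset_span (R := ℝ) (hcone _ h2))
      (Submodule.subset_span (hcone _ h1))
    simpa using this
  rw [htop]
  exact dense_univ

/-- Moving by s in a tangential direction, φ changes sign between the normal corrections r = -δ and
r = δ, so the intermediate value theorem finds a zero. This replaces curves in the boundary and the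
implicit function theorem. -/
theorem exists_frontier_point (hφ : IsDefiningFunction φ Ω) {g τ : E} (hg : g ∈ frontier Ω)
    (hτ : fderiv ℝ φ g τ = 0) {δ : ℝ} (hδ : 0 < δ) :
    ∃ s : ℝ, 0 < s ∧ s < δ ∧ ∃ r : ℝ, |r| ≤ δ ∧
      g + s • (τ + r • gradient φ g) ∈ frontier Ω := by
  have hg0 := hφ.eq_zero_of_mem_frontier hg
  have hp := hφ.fderiv_gradient_pos hg
  set N := gradient φ g
  have hφ1 : ContDiff ℝ 1 φ := hφ.contDiff.of_le (by norm_num)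
  have hneg := hφ.eventually_neg (v := τ + (-δ) • N) hg0 (by
    simp only [map_add, map_smul, hτ, smul_eq_mul]
    have := mul_pos hδ hp
    linarith)
  have hpos := hφ.eventually_pos (v := τ + δ • N) hg0 (by
    simp only [map_add, map_smul, hτ, smul_eq_mul]
    have := mul_pos hδ hp
    linarith)
  have hlt : ∀ᶠ s : ℝ in 𝓝[>] 0, s < δ := nhdsWithin_le_nhds (Iio_mem_nhds hδ)
  -- A zero of φ need not be a boundary point unless dφ is nonzero there. Compactness of the range
  -- of r makes this uniform for small s.
  have hd : ∀ᶠ s : ℝ in 𝓝[>] 0, ∀ r ∈ Set.Icc (-δ) δ, fderiv ℝ φ (g + s • (τ + r • N)) ≠ 0 := by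
    refine nhdsWithin_le_nhds (isCompact_Icc.eventually_forall_of_forall_eventually fun r _ => ?_)
    have hc : Continuous fun p : ℝ × ℝ => fderiv ℝ φ (g + p.1 • (τ + p.2 • N)) :=
      (hφ1.continuous_fderiv one_ne_zero).comp (by fun_prop)
    exact hc.continuousAt.eventually_ne (by simpa using hφ.fderiv_ne_zero g hg)
  obtain ⟨s, hs1, hs2, hs3, hs4, hs5⟩ :=
    (hneg.and (hpos.and (hlt.and (hd.and self_mem_nhdsWithin)))).exists
  have hcont : ContinuousOn (fun r : ℝ => φ (g + s • (τ + r • N))) (Set.Icc (-δ) δ) :=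
    (hφ.contDiff.continuous.comp (by fun_prop)).continuousOn
  obtain ⟨r, hr, hr0⟩ := intermediate_value_Icc (by linarith) hcont ⟨hs1.le, hs2.le⟩
  exact ⟨s, hs5, hs3, r, abs_le.2 hr, hφ.mem_frontier hr0 (hs4 r hr)⟩

/-- The derivative of a function vanishing on the boundary vanishes in tangential directions. -/
theorem hasFDerivWithinAt_tangent_eq_zero (hφ : IsDefiningFunction φ Ω) {g τ : E}
    (hg : g ∈ frontier Ω) (hτ : fderiv ℝ φ g τ = 0) {q : E → ℝ} {q' : E →L[ℝ] ℝ}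
    (hq : HasFDerivWithinAt q q' (closure Ω) g) (hq0 : ∀ x ∈ frontier Ω, q x = 0) :
    q' τ = 0 := by
  choose s hs0 hs1 r hr hmem using fun n : ℕ =>
    hφ.exists_frontier_point hg hτ (Nat.one_div_pos_of_nat (α := ℝ) (n := n))
  have hz := tendsto_one_div_add_atTop_nhds_zero_nat (𝕜 := ℝ)
  have hsl : Filter.Tendsto s Filter.atTop (𝓝 0) :=
    squeeze_zero (fun n => (hs0 n).le) (fun n => (hs1 n).le) hz
  have hrl : Filter.Tendsto r Filter.atTop (𝓝 0) := squeeze_zero_norm hr hz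
  have hv : Filter.Tendsto (fun n => τ + r n • gradient φ g) Filter.atTop (𝓝 τ) := by
    simpa using (tendsto_const_nhds (x := τ)).add (hrl.smul_const (gradient φ g))
  -- The difference quotients along boundary points approaching g in direction τ converge to the
  -- derivative, and all of them are zero.
  have hlim := hq.lim (l := Filter.atTop) (c := fun n => (s n)⁻¹)
    (d := fun n => s n • (τ + r n • gradient φ g)) (v := τ) (by simpa using hsl.smul hv)
    (Filter.Eventually.of_forall fun n => frontier_subset_closure (hmem n))
    (hv.congr fun n => by rw [inv_smul_smul₀ (hs0 n).ne'])
  have h0 : ∀ n, (s n)⁻¹ • (q (g + s n • (τ + r n • gradient φ g)) - q g) = 0 := fun n => by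
    rw [hq0 _ (hmem n), hq0 _ hg, sub_zero, smul_zero]
  simp only [h0] at hlim
  exact (tendsto_nhds_unique hlim tendsto_const_nhds)

/-- A vector orthogonal to the kernel of `dφ` is a multiple of the gradient of `φ`. -/
theorem exists_eq_smul_gradient (hφ : IsDefiningFunction φ Ω) {g p : E} (hg : g ∈ frontier Ω)
    (hp : ∀ τ, fderiv ℝ φ g τ = 0 → ⟪p, τ⟫_ℝ = 0) : ∃ c : ℝ, p = c • gradient φ g := by
  have hN := hφ.fderiv_gradient_pos hg
  set N := gradient φ g with hNdef
  have hpN : ∀ v, ⟪p, v⟫_ℝ = fderiv ℝ φ g v / fderiv ℝ φ g N * ⟪p, N⟫_ℝ := by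
    intro v
    have := hp (v - (fderiv ℝ φ g v / fderiv ℝ φ g N) • N) (by
      simp only [map_sub, map_smul, smul_eq_mul]
      field_simp
      ring)
    rw [inner_sub_right, inner_smul_right, sub_eq_zero] at this
    exact this
  refine ⟨⟪p, N⟫_ℝ / fderiv ℝ φ g N, ext_inner_right ℝ fun v => ?_⟩
  rw [hpN v, inner_smul_left, hNdef, inner_gradient_eq, ← hNdef]
  simp only [conj_trivial]
  ring

/-- The second-order jet of a `C²` function on the closure of a domain, vanishing on the boundary,
extends continuously to the boundary, where it is proportional to the jet of the defining function
in tangential directions. -/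
theorem exists_jet_extension (hφ : IsDefiningFunction φ Ω) {u : E → ℝ}
    (hu : ContDiffOn ℝ 2 u (closure Ω)) (hu0 : ∀ g ∈ frontier Ω, u g = 0) :
    ∃ j : E → Jet E, ContinuousOn j (closure Ω) ∧ (∀ g ∈ Ω, j g = jet u g) ∧
      ∀ g ∈ frontier Ω, (j g).1 = 0 ∧ ∃ c : ℝ, (j g).2.1 = c • gradient φ g ∧
        ∀ τ, fderiv ℝ φ g τ = 0 →
          ⟪(j g).2.2 τ, τ⟫_ℝ = c * ⟪fderiv ℝ (gradient φ) g τ, τ⟫_ℝ := by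
  have hU := hφ.uniqueDiffOn_closure
  let D := (InnerProductSpace.toDual ℝ E).symm
  let p : E → E := fun g => D (fderivWithin ℝ u (closure Ω) g)
  have hpi : ∀ g v, ⟪p g, v⟫_ℝ = fderivWithin ℝ u (closure Ω) g v := fun g v => by
    simp [p, D]
  have hp1 : ContDiffOn ℝ 1 p (closure Ω) :=
    D.contDiff.comp_contDiffOn (hu.fderivWithin hU (by norm_num))
  have hpc : ContinuousOn p (closure Ω) := hp1.continuousOn
  have hHc : ContinuousOn (fderivWithin ℝ p (closure Ω)) (closure Ω) :=
    hp1.continuousOn_fderivWithin hU le_rfl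
  refine ⟨fun g => (u g, p g, fderivWithin ℝ p (closure Ω) g),
    hu.continuousOn.prodMk (hpc.prodMk hHc), fun g hg => ?_, fun g hg => ⟨hu0 g hg, ?_⟩⟩
  · have hn : ∀ x ∈ Ω, closure Ω ∈ 𝓝 x := fun x hx =>
      Filter.mem_of_superset (hφ.isOpen.mem_nhds hx) subset_closure
    have hpe : p =ᶠ[𝓝 g] gradient u := by
      filter_upwards [hφ.isOpen.mem_nhds hg] with x hx
      change D (fderivWithin ℝ u (closure Ω) x) = D (fderiv ℝ u x)
      rw [fderivWithin_of_mem_nhds (hn x hx)]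
    simp only [jet]
    rw [hpe.eq_of_nhds, fderivWithin_of_mem_nhds (hn g hg), hpe.fderiv_eq]
  · have htan : ∀ x ∈ frontier Ω, ∀ τ, fderiv ℝ φ x τ = 0 → ⟪p x, τ⟫_ℝ = 0 := by
      intro x hx τ hτ
      rw [hpi]
      exact hφ.hasFDerivWithinAt_tangent_eq_zero hx hτ
        ((hu.differentiableOn two_ne_zero) x (frontier_subset_closure hx)).hasFDerivWithinAt hu0
    have hpar := fun x hx => hφ.exists_eq_smul_gradient hx (htan x hx)
    obtain ⟨c, hc⟩ := hpar g hg
    refine ⟨c, hc, fun τ hτ => ?_⟩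
    have hN := hφ.fderiv_gradient_pos hg
    set N := gradient φ g with hNdef
    have hpd : HasFDerivWithinAt p (fderivWithin ℝ p (closure Ω) g) (closure Ω) g :=
      (hp1.differentiableOn one_ne_zero g (frontier_subset_closure hg)).hasFDerivWithinAt
    have hgd : HasFDerivWithinAt (gradient φ) (fderiv ℝ (gradient φ) g) (closure Ω) g :=
      ((_root_.contDiff_gradient hφ.contDiff).differentiable one_ne_zero g).hasFDerivAt.hasFDerivWithinAt
    -- With τ and N frozen, q(x) = ⟪p x, τ⟫⟪∇φ x, N⟫ - ⟪p x, N⟫⟪∇φ x, τ⟫ vanishes on the boundary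
    -- because p is parallel to ∇φ there. Its derivative along τ at g compares the two Hessians,
    -- without requiring the factor c to be differentiable.
    have hq := ((hpd.inner ℝ (hasFDerivWithinAt_const τ g _)).mul
      (hgd.inner ℝ (hasFDerivWithinAt_const N g _))).sub
      ((hpd.inner ℝ (hasFDerivWithinAt_const N g _)).mul
      (hgd.inner ℝ (hasFDerivWithinAt_const τ g _)))
    have h0 := hφ.hasFDerivWithinAt_tangent_eq_zero hg hτ hq (fun x hx => by
      obtain ⟨c', hc'⟩ := hpar x hx
      simp only [Pi.sub_apply, Pi.mul_apply, hc', inner_smul_left, conj_trivial]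
      ring)
    have e1 : ⟪N, τ⟫_ℝ = 0 := by rw [hNdef, inner_gradient_eq, hτ]
    have e2 : ⟪p g, τ⟫_ℝ = 0 := htan g hg τ hτ
    have e3 : ⟪p g, N⟫_ℝ = c * ⟪N, N⟫_ℝ := by rw [hc, inner_smul_left]; rfl
    have e4 : ⟪N, N⟫_ℝ ≠ 0 := by
      rw [real_inner_self_eq_norm_sq]
      have := hφ.gradient_ne_zero hg
      positivity
    simp [e1, e2, e3, ← hNdef] at h0
    have h5 : ⟪N, N⟫_ℝ * (⟪fderivWithin ℝ p (closure Ω) g τ, τ⟫_ℝ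
        - c * ⟪fderiv ℝ (gradient φ) g τ, τ⟫_ℝ) = 0 := by
      rw [real_inner_self_eq_norm_sq]
      linarith
    exact sub_eq_zero.1 ((mul_eq_zero.1 h5).resolve_left e4)

end IsDefiningFunction

end Boundary

/-! ### Second derivatives along vector fields -/

section SecondDerivative

variable {E : Type*} [NormedAddCommGroup E] [InnerProductSpace ℝ E] [FiniteDimensional ℝ E]

theorem differentiableAt_gradient {u : E → ℝ} {g : E} (hu : ContDiffAt ℝ 2 u g) :
    DifferentiableAt ℝ (gradient u) g :=
  (InnerProductSpace.toDual ℝ E).symm.differentiable.differentiableAt.comp g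
    ((hu.fderiv_right (m := 1) (by norm_num)).differentiableAt one_ne_zero)

/-- The derivative along `η` of the derivative of `u` along a vector field `ξ`. -/
theorem fderiv_fderiv_apply {u : E → ℝ} {g : E} (hu : ContDiffAt ℝ 2 u g) {ξ : E → E}
    (hξ : DifferentiableAt ℝ ξ g) (η : E) :
    fderiv ℝ (fun x => fderiv ℝ u x (ξ x)) g η
      = ⟪fderiv ℝ (gradient u) g η, ξ g⟫_ℝ + fderiv ℝ u g (fderiv ℝ ξ g η) := by
  have h : (fun x => fderiv ℝ u x (ξ x)) = fun x => ⟪gradient u x, ξ x⟫_ℝ :=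
    funext fun x => (inner_gradient_eq x (ξ x)).symm
  rw [h, fderiv_inner_apply ℝ (differentiableAt_gradient hu) hξ, inner_gradient_eq, add_comm]

theorem inner_fderiv_gradient_comm {u : E → ℝ} {g : E} (hu : ContDiffAt ℝ 2 u g) (x y : E) :
    ⟪fderiv ℝ (gradient u) g x, y⟫_ℝ = ⟪fderiv ℝ (gradient u) g y, x⟫_ℝ := by
  have key : ∀ x y, ⟪fderiv ℝ (gradient u) g x, y⟫_ℝ = fderiv ℝ (fderiv ℝ u) g x y := by
    intro x y
    have h := fderiv_fderiv_apply hu (differentiableAt_const y) x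
    rw [fderiv_fun_const, Pi.zero_apply, zero_apply, map_zero, add_zero] at h
    have hd : DifferentiableAt ℝ (fderiv ℝ u) g :=
      (hu.fderiv_right (m := 1) (by norm_num)).differentiableAt one_ne_zero
    rw [← h, fderiv_clm_apply hd (differentiableAt_const y)]
    simp
  rw [key, key]
  exact (hu.isSymmSndFDerivAt (by simp)).eq x y

end SecondDerivative

namespace StepTwoCarnot

variable {m : ℕ} {𝔤 : Type*} [NormedAddCommGroup 𝔤] [InnerProductSpace ℝ 𝔤]
  [FiniteDimensional ℝ 𝔤] (G : StepTwoCarnot m 𝔤)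

/-! ### The left-invariant fields and the dilation field -/

/-- The horizontal left-invariant vector field generated by `e_i`. -/
def horField (i : Fin m) (g : 𝔤) : 𝔤 := G.leftInv (G.e i : 𝔤) g

/-- The linear part of the affine map `G.leftInv ξ`. -/
def leftInvLin (ξ : 𝔤) : 𝔤 →L[ℝ] 𝔤 := LinearMap.toContinuousLinearMap ((1 / 2 : ℝ) • G.bracket.flip ξ)

theorem leftInvLin_apply (ξ g : 𝔤) : G.leftInvLin ξ g = (1 / 2 : ℝ) • G.bracket g ξ := rfl

theorem hasFDerivAt_leftInv (ξ g : 𝔤) : HasFDerivAt (G.leftInv ξ) (G.leftInvLin ξ) g :=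
  (G.leftInvLin ξ).hasFDerivAt.const_add ξ

theorem contDiff_leftInv (ξ : 𝔤) {n : WithTop ℕ∞} : ContDiff ℝ n (G.leftInv ξ) :=
  contDiff_const.add (G.leftInvLin ξ).contDiff

theorem contDiff_horField (i : Fin m) {n : WithTop ℕ∞} : ContDiff ℝ n (G.horField i) :=
  G.contDiff_leftInv _

theorem hasFDerivAt_horField (i : Fin m) (g : 𝔤) :
    HasFDerivAt (G.horField i) (G.leftInvLin (G.e i : 𝔤)) g := G.hasFDerivAt_leftInv _ g

theorem continuous_horField (i : Fin m) : Continuous (G.horField i) :=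
  (G.contDiff_horField i (n := 0)).continuous

theorem bracket_bracket_left (x y z : 𝔤) : G.bracket (G.bracket x y) z = 0 := by
  rw [G.bracket_skew, G.bracket_V₂ _ _ (G.bracket_mem_V₂ x y), neg_zero]

theorem bracket_leftInv (ξ g y : 𝔤) : G.bracket (G.leftInv ξ g) y = G.bracket ξ y := by
  rw [leftInv, map_add, map_smul, LinearMap.add_apply, LinearMap.smul_apply,
    G.bracket_bracket_left, smul_zero, add_zero]

/-- Brackets are central, so this linear part has square zero. Hence left-invariant fields are
divergence free, and the divergence of f X_i is X_i f. -/
theorem trace_leftInvLin (ξ : 𝔤) : LinearMap.trace ℝ 𝔤 (G.leftInvLin ξ : 𝔤 →ₗ[ℝ] 𝔤) = 0 := by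
  refine (LinearMap.isNilpotent_trace_of_isNilpotent ⟨2, ?_⟩).eq_zero
  ext x
  simp [pow_two, leftInvLin_apply, G.bracket_bracket_left]

theorem euclDiv_smul_horField {f : 𝔤 → ℝ} {g : 𝔤} (hf : DifferentiableAt ℝ f g) (i : Fin m) :
    euclDiv (fun x => f x • G.horField i x) g = fderiv ℝ f g (G.horField i g) := by
  have h := G.hasFDerivAt_horField i g
  rw [euclDiv_smul hf h.differentiableAt]
  have : euclDiv (G.horField i) g = 0 := by
    rw [euclDiv, h.fderiv, G.trace_leftInvLin]
  rw [this, mul_zero, zero_add]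

/-- The generator of the dilations as a linear vector field. -/
def dilationLin : 𝔤 →L[ℝ] 𝔤 := G.V₁.starProjection + (2 : ℝ) • G.V₂.starProjection

theorem dilationLin_apply (g : 𝔤) : G.dilationLin g = G.dilationField g := rfl

theorem dilationField_eq (g : 𝔤) : G.dilationField g = g + G.V₂.starProjection g := by
  rw [dilationField, two_smul, ← add_assoc, G.starProjection_add]

theorem bracket_dilationField_right (x g : 𝔤) :
    G.bracket x (G.dilationField g) = G.bracket x g := by
  rw [dilationField_eq, map_add, G.bracket_V₂ _ _ (Submodule.starProjection_apply_mem _ _),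
    add_zero]

theorem leftInv_dilationField (g : 𝔤) : G.leftInv (G.dilationField g) g = G.dilationField g := by
  rw [leftInv, G.bracket_dilationField_right, G.bracket_self, smul_zero, add_zero]

theorem dilationField_horField (i : Fin m) (g : 𝔤) :
    G.dilationField (G.horField i g) = G.horField i g + (1 / 2 : ℝ) • G.bracket g (G.e i : 𝔤) := by
  rw [dilationField_eq, horField, leftInv, map_add, map_smul,
    (Submodule.starProjection_apply_eq_zero_iff _).2 (G.orthogonal (G.e i).2),
    Submodule.starProjection_eq_self_iff.2 (G.bracket_mem_V₂ g _), zero_add]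

/-! ### Derivatives along the fields in terms of jets -/

/-- `X_i u` as a function of the jet of `u`. -/
def jetX (i : Fin m) (p : 𝔤 × Jet 𝔤) : ℝ := ⟪p.2.2.1, G.horField i p.1⟫_ℝ

/-- `[X_i, X_j] u` as a function of the jet of `u`. -/
def jetT (i j : Fin m) (p : 𝔤 × Jet 𝔤) : ℝ := ⟪p.2.2.1, G.bracket (G.e i : 𝔤) (G.e j)⟫_ℝ

/-- `X_i X_j u` as a function of the jet of `u`. -/
def jetXX (i j : Fin m) (p : 𝔤 × Jet 𝔤) : ℝ :=
  ⟪p.2.2.2 (G.horField i p.1), G.horField j p.1⟫_ℝ + 1 / 2 * G.jetT i j p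

/-- `Z u` as a function of the jet of `u`. -/
def jetZ (p : 𝔤 × Jet 𝔤) : ℝ := ⟪p.2.2.1, G.dilationField p.1⟫_ℝ

theorem continuous_jetX (i : Fin m) : Continuous (G.jetX i) := by
  have := G.continuous_horField
  unfold jetX
  fun_prop

theorem continuous_jetT (i j : Fin m) : Continuous (G.jetT i j) := by
  unfold jetT
  fun_prop

theorem continuous_jetXX (i j : Fin m) : Continuous (G.jetXX i j) := by
  have := G.continuous_horField
  have := G.continuous_jetT
  unfold jetXX
  fun_prop

theorem continuous_jetZ : Continuous G.jetZ := by
  have : Continuous G.dilationField := G.dilationLin.continuous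
  unfold jetZ
  fun_prop

variable {u : 𝔤 → ℝ} {g : 𝔤}

theorem X_eq_fderiv (hu : DifferentiableAt ℝ u g) (i : Fin m) :
    G.X i u g = fderiv ℝ u g (G.horField i g) := hu.lineDeriv_eq_fderiv

theorem X_eq_jetX (hu : DifferentiableAt ℝ u g) (i : Fin m) :
    G.X i u g = G.jetX i (g, jet u g) := by
  rw [G.X_eq_fderiv hu, ← inner_gradient_eq]
  rfl

theorem X_eventuallyEq (hu : ContDiffAt ℝ 2 u g) (i : Fin m) :
    G.X i u =ᶠ[𝓝 g] fun x => fderiv ℝ u x (G.horField i x) := by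
  filter_upwards [hu.eventually (by simp)] with x hx
  exact G.X_eq_fderiv (hx.differentiableAt two_ne_zero) i

theorem contDiffAt_X {n : WithTop ℕ∞} (hu : ContDiffAt ℝ (n + 1) u g) (h2 : ContDiffAt ℝ 2 u g)
    (i : Fin m) : ContDiffAt ℝ n (G.X i u) g :=
  ((hu.fderiv_right le_rfl).clm_apply (G.contDiff_horField i).contDiffAt).congr_of_eventuallyEq
    (G.X_eventuallyEq h2 i)

theorem X_X_eq_jetXX (hu : ContDiffAt ℝ 2 u g) (i j : Fin m) :
    G.X i (G.X j u) g = G.jetXX i j (g, jet u g) := by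
  have h1 : DifferentiableAt ℝ (G.X j u) g :=
    (G.contDiffAt_X (n := 1) hu hu j).differentiableAt one_ne_zero
  have h2 := G.hasFDerivAt_horField j g
  rw [G.X_eq_fderiv h1, (G.X_eventuallyEq hu j).fderiv_eq,
    fderiv_fderiv_apply hu h2.differentiableAt]
  have h3 : fderiv ℝ (G.horField j) g (G.horField i g)
      = (1 / 2 : ℝ) • G.bracket (G.e i : 𝔤) (G.e j) := by
    rw [h2.fderiv, leftInvLin_apply, horField,
      G.bracket_leftInv]
  rw [h3, map_smul, ← inner_gradient_eq]
  rfl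

theorem jetXX_sub (hu : ContDiffAt ℝ 2 u g) (i j : Fin m) :
    G.jetXX i j (g, jet u g) - G.jetXX j i (g, jet u g) = G.jetT i j (g, jet u g) := by
  have h : G.jetT j i (g, jet u g) = -G.jetT i j (g, jet u g) := by
    rw [jetT, jetT, G.bracket_skew, inner_neg_right]
  rw [jetXX, jetXX, h]
  have := inner_fderiv_gradient_comm hu (G.horField i g) (G.horField j g)
  simp only [jet]
  rw [this]
  ring

theorem comm_eq_jetT (hu : ContDiffAt ℝ 2 u g) (i j : Fin m) :
    G.comm i j u g = G.jetT i j (g, jet u g) := by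
  rw [comm, G.X_X_eq_jetXX hu, G.X_X_eq_jetXX hu, G.jetXX_sub hu]

/-! ### Smooth functions -/

variable {v : 𝔤 → ℝ}

theorem contDiff_X (hv : ContDiff ℝ (⊤ : ℕ∞) v) (i : Fin m) : ContDiff ℝ (⊤ : ℕ∞) (G.X i v) :=
  contDiff_iff_contDiffAt.2 fun _ =>
    G.contDiffAt_X hv.contDiffAt (contDiff_infty.1 hv 2).contDiffAt i

theorem X_apply (hv : ContDiff ℝ (⊤ : ℕ∞) v) (i : Fin m) (g : 𝔤) :
    G.X i v g = fderiv ℝ v g (G.horField i g) :=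
  G.X_eq_fderiv (hv.differentiable (by simp) g) i

theorem X_sub_X (hv : ContDiff ℝ (⊤ : ℕ∞) v) (i j : Fin m) (g : 𝔤) :
    G.X i (G.X j v) g - G.X j (G.X i v) g = fderiv ℝ v g (G.bracket (G.e i : 𝔤) (G.e j)) := by
  rw [← inner_gradient_eq]
  exact G.comm_eq_jetT (contDiff_infty.1 hv 2).contDiffAt i j

/-- Central directions commute with every X_i: the coefficients of X_i do not vary along V₂. -/
theorem X_fderiv_apply_of_mem_V₂ (hv : ContDiff ℝ (⊤ : ℕ∞) v) (i : Fin m) {c : 𝔤} (hc : c ∈ G.V₂)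
    (g : 𝔤) : fderiv ℝ (fun x => fderiv ℝ v x c) g (G.horField i g) = fderiv ℝ (G.X i v) g c := by
  have h2 : ContDiffAt ℝ 2 v g := (contDiff_infty.1 hv 2).contDiffAt
  have h := G.hasFDerivAt_horField i g
  rw [(G.X_eventuallyEq h2 i).fderiv_eq, fderiv_fderiv_apply h2 (differentiableAt_const c),
    fderiv_fderiv_apply h2 h.differentiableAt, inner_fderiv_gradient_comm h2]
  rw [h.fderiv, leftInvLin_apply,
    G.bracket_skew c, G.bracket_V₂ _ c hc]
  simp

/-- The double commutator `[X_i, [X_i, X_j]]` vanishes. -/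
theorem X_double_commutator (hv : ContDiff ℝ (⊤ : ℕ∞) v) (i j : Fin m) (g : 𝔤) :
    G.X i (G.X i (G.X j v)) g - 2 * G.X i (G.X j (G.X i v)) g + G.X j (G.X i (G.X i v)) g = 0 := by
  have hX := G.contDiff_X hv
  have hXX := fun k l => G.contDiff_X (hX k) l
  have h1 := G.X_sub_X (hX i) i j g
  have h2 : (fun x => G.X i (G.X j v) x - G.X j (G.X i v) x)
      = fun x => fderiv ℝ v x (G.bracket (G.e i : 𝔤) (G.e j)) := funext (G.X_sub_X hv i j)
  have h3 : G.X i (G.X i (G.X j v)) g - G.X i (G.X j (G.X i v)) g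
      = fderiv ℝ (fun x => G.X i (G.X j v) x - G.X j (G.X i v) x) g (G.horField i g) := by
    rw [fderiv_fun_sub ((hXX j i).differentiable (by simp) g)
      ((hXX i j).differentiable (by simp) g), G.X_apply (hXX j i), G.X_apply (hXX i j)]
    rfl
  rw [h2, G.X_fderiv_apply_of_mem_V₂ hv i (G.bracket_mem_V₂ _ _), ← h1] at h3
  linarith

theorem euclDiv_sum_smul_horField {f : Fin m → 𝔤 → ℝ} {g : 𝔤}
    (hf : ∀ i, DifferentiableAt ℝ (f i) g) :
    euclDiv (fun x => ∑ i, f i x • G.horField i x) g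
      = ∑ i, fderiv ℝ (f i) g (G.horField i g) := by
  rw [euclDiv_sum]
  · exact Finset.sum_congr rfl fun i _ => G.euclDiv_smul_horField (hf i) i
  · exact fun i _ => (hf i).smul ((G.contDiff_horField i).differentiable one_ne_zero g)

end StepTwoCarnot

theorem IsDivergence.sub_smul {E : Type*} [NormedAddCommGroup E] [InnerProductSpace ℝ E]
    [FiniteDimensional ℝ E] [MeasurableSpace E] [BorelSpace E]
    {d d' : E × Jet E → ℝ} {F F' : E × Jet E → E}
    (h : IsDivergence d F) (h' : IsDivergence d' F') (c : ℝ) :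
    IsDivergence (fun p => d p - c * d' p) (fun p => F p - c • F' p) where
  continuous_div := h.continuous_div.sub (continuous_const.mul h'.continuous_div)
  continuous_field := h.continuous_field.sub (h'.continuous_field.const_smul c)
  contDiff v hv := (h.contDiff v hv).sub ((h'.contDiff v hv).const_smul c)
  euclDiv_eq v hv g := by
    have h1 := (h.contDiff v hv).differentiable one_ne_zero g
    have h2 := (h'.contDiff v hv).differentiable one_ne_zero g
    rw [← h.euclDiv_eq v hv, ← h'.euclDiv_eq v hv]
    simp only [euclDiv]
    rw [(h1.hasFDerivAt.fun_sub (h2.hasFDerivAt.fun_const_smul c)).fderiv]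
    simp

/-! ### The four divergence identities -/

namespace StepTwoCarnot

variable {m : ℕ} {𝔤 : Type*} [NormedAddCommGroup 𝔤] [InnerProductSpace ℝ 𝔤]
  [FiniteDimensional ℝ 𝔤] (G : StepTwoCarnot m 𝔤)

/-- The components of the field whose divergence is `2 F₂[u] + 3/4 ∑ ([X_i, X_j] u)²`. -/
def hessianCoef (i : Fin m) (p : 𝔤 × Jet 𝔤) : ℝ :=
  ∑ j, (G.jetX i p * G.jetXX j j p - G.jetX j p * G.jetXX j i p + G.jetT i j p * G.jetX j p)

/-- The field whose divergence is `2 F₂[u] + 3/4 ∑ ([X_i, X_j] u)²`. -/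
def hessianField (p : 𝔤 × Jet 𝔤) : 𝔤 := ∑ i, G.hessianCoef i p • G.horField i p.1

/-- The divergence of `hessianField`. -/
def hessianDiv (p : 𝔤 × Jet 𝔤) : ℝ :=
  ∑ i, ∑ j, (G.jetXX i i p * G.jetXX j j p - G.jetXX i j p * G.jetXX j i p
    + 1 / 2 * G.jetT i j p ^ 2)

/-- The square of the norm of the horizontal gradient. -/
def jetNormSq (p : 𝔤 × Jet 𝔤) : ℝ := ∑ i, G.jetX i p ^ 2

/-- The horizontal Laplacian as a function of the jet. -/
def jetLap (p : 𝔤 × Jet 𝔤) : ℝ := ∑ i, G.jetXX i i p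

/-- The field `2 Zu ∇ᴴu - |∇ᴴu|² Z` of the Rellich identity. -/
def rellichField (p : 𝔤 × Jet 𝔤) : 𝔤 :=
  (∑ i, (2 * G.jetZ p * G.jetX i p) • G.horField i p.1) - G.jetNormSq p • G.dilationField p.1

/-- The homogeneous dimension, as the divergence of the dilation field. -/
def homDim : ℝ := LinearMap.trace ℝ 𝔤 (G.dilationLin : 𝔤 →ₗ[ℝ] 𝔤)

/-- The divergence of `rellichField`. -/
def rellichDiv (p : 𝔤 × Jet 𝔤) : ℝ :=
  2 * G.jetZ p * G.jetLap p + (2 - G.homDim) * G.jetNormSq p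

/-- The field `u ∇ᴴu`. -/
def energyField (p : 𝔤 × Jet 𝔤) : 𝔤 := ∑ i, (p.2.1 * G.jetX i p) • G.horField i p.1

/-- The divergence of `energyField`. -/
def energyDiv (p : 𝔤 × Jet 𝔤) : ℝ := G.jetNormSq p + p.2.1 * G.jetLap p

/-- The field `x_i u² X_i`. -/
def poincareField (i : Fin m) (p : 𝔤 × Jet 𝔤) : 𝔤 :=
  (⟪(G.e i : 𝔤), p.1⟫_ℝ * p.2.1 ^ 2) • G.horField i p.1

/-- The divergence of `poincareField`. -/
def poincareDiv (i : Fin m) (p : 𝔤 × Jet 𝔤) : ℝ :=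
  p.2.1 ^ 2 + 2 * ⟪(G.e i : 𝔤), p.1⟫_ℝ * p.2.1 * G.jetX i p

section Smooth

variable {v : 𝔤 → ℝ}

theorem jetX_smooth (hv : ContDiff ℝ (⊤ : ℕ∞) v) (i : Fin m) (g : 𝔤) : G.jetX i (g, jet v g) = G.X i v g :=
  (G.X_eq_jetX (hv.differentiable (by simp) g) i).symm

theorem jetXX_smooth (hv : ContDiff ℝ (⊤ : ℕ∞) v) (i j : Fin m) (g : 𝔤) :
    G.jetXX i j (g, jet v g) = G.X i (G.X j v) g :=
  (G.X_X_eq_jetXX (contDiff_infty.1 hv 2).contDiffAt i j).symm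

theorem jetT_smooth (hv : ContDiff ℝ (⊤ : ℕ∞) v) (i j : Fin m) (g : 𝔤) :
    G.jetT i j (g, jet v g) = G.X i (G.X j v) g - G.X j (G.X i v) g :=
  (G.comm_eq_jetT (contDiff_infty.1 hv 2).contDiffAt i j).symm

theorem jetZ_jet (g : 𝔤) : G.jetZ (g, jet v g) = fderiv ℝ v g (G.dilationField g) :=
  inner_gradient_eq g _

theorem contDiff_dilation_deriv (hv : ContDiff ℝ (⊤ : ℕ∞) v) :
    ContDiff ℝ 1 fun g => fderiv ℝ v g (G.dilationField g) :=
  ((contDiff_infty.1 hv 2).fderiv_right (m := 1) (by norm_num)).clm_apply G.dilationLin.contDiff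

/-- The commutator `[X_i, Z] = X_i`. -/
theorem X_dilation_commutator (hv : ContDiff ℝ (⊤ : ℕ∞) v) (i : Fin m) (g : 𝔤) :
    fderiv ℝ (fun x => fderiv ℝ v x (G.dilationField x)) g (G.horField i g)
      = fderiv ℝ (G.X i v) g (G.dilationField g) + G.X i v g := by
  have h2 : ContDiffAt ℝ 2 v g := (contDiff_infty.1 hv 2).contDiffAt
  have hZ : HasFDerivAt G.dilationField G.dilationLin g := G.dilationLin.hasFDerivAt
  have hX := G.hasFDerivAt_horField i g
  rw [(G.X_eventuallyEq h2 i).fderiv_eq, fderiv_fderiv_apply h2 hZ.differentiableAt,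
    fderiv_fderiv_apply h2 hX.differentiableAt, inner_fderiv_gradient_comm h2, hZ.fderiv,
    hX.fderiv, leftInvLin_apply, dilationLin_apply, dilationField_horField, G.X_apply hv,
    G.bracket_skew (G.dilationField g), G.bracket_dilationField_right, ← G.bracket_skew, map_add]
  ring

end Smooth

variable [MeasurableSpace 𝔤] [BorelSpace 𝔤]

/-- After exchanging i and j in one sum, the third-order terms become X_j v times the double
commutator [X_i, [X_i, X_j]] v, which is zero; the term `jetT i j * jetX j` in the field is there to
produce exactly this combination. What it leaves at second order, ∑ T_ij v X_i X_j v, is half of ∑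
(T_ij v)² by antisymmetry. -/
theorem isDivergence_hessian : IsDivergence G.hessianDiv G.hessianField where
  continuous_div := by
    have := G.continuous_jetXX
    have := G.continuous_jetT
    unfold hessianDiv
    fun_prop
  continuous_field := by
    have := G.continuous_jetX
    have := G.continuous_jetXX
    have := G.continuous_jetT
    have := G.continuous_horField
    unfold hessianField hessianCoef
    fun_prop
  contDiff v hv := by
    have hX : ∀ i, ContDiff ℝ 1 (G.X i v) := fun i => contDiff_infty.1 (G.contDiff_X hv i) 1
    have hXX : ∀ i j, ContDiff ℝ 1 (G.X i (G.X j v)) :=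
      fun i j => contDiff_infty.1 (G.contDiff_X (G.contDiff_X hv j) i) 1
    have hH := fun i => G.contDiff_horField i (n := 1)
    simp only [hessianField, hessianCoef, G.jetX_smooth hv, G.jetXX_smooth hv, G.jetT_smooth hv]
    fun_prop
  euclDiv_eq v hv g := by
    have hX := G.contDiff_X hv
    have hXX := fun i j => G.contDiff_X (hX i) j
    have dX := fun i => (hX i).differentiable (by simp) g
    have dXX := fun i j => (hXX i j).differentiable (by simp) g
    have hcoef : ∀ i g, G.hessianCoef i (g, jet v g) = ∑ j, (G.X i v g * G.X j (G.X j v) g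
        - G.X j v g * G.X j (G.X i v) g
        + (G.X i (G.X j v) g - G.X j (G.X i v) g) * G.X j v g) := by
      intro i g
      simp only [hessianCoef, G.jetX_smooth hv, G.jetXX_smooth hv, G.jetT_smooth hv]
    have hder : ∀ i, HasFDerivAt (fun x => G.hessianCoef i (x, jet v x)) _ g := fun i => by
      simp only [hcoef]
      exact HasFDerivAt.fun_sum fun j _ =>
        (((dX i).hasFDerivAt.mul (dXX j j).hasFDerivAt).sub
          ((dX j).hasFDerivAt.mul (dXX i j).hasFDerivAt)).add
          (((dXX j i).hasFDerivAt.sub (dXX i j).hasFDerivAt).mul (dX j).hasFDerivAt)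
    simp only [hessianField]
    rw [G.euclDiv_sum_smul_horField fun i => (hder i).differentiableAt]
    have hXa : ∀ {w : 𝔤 → ℝ}, ContDiff ℝ (⊤ : ℕ∞) w → ∀ i, fderiv ℝ w g (G.horField i g)
        = G.X i w g := fun hw i => (G.X_apply hw i g).symm
    simp only [(hder _).fderiv, sum_apply, add_apply, sub_apply, smul_apply, smul_eq_mul,
      hXa (hX _), hXa (hXX _ _), Pi.sub_apply]
    simp only [hessianDiv, G.jetXX_smooth hv, G.jetT_smooth hv]
    have e1 : ∑ i, ∑ j, G.X i v g * G.X i (G.X j (G.X j v)) g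
        = ∑ i, ∑ j, G.X j v g * G.X j (G.X i (G.X i v)) g := Finset.sum_comm
    have e2 : ∑ i, ∑ j, (G.X i (G.X j v) g - G.X j (G.X i v) g) * G.X i (G.X j v) g
        = ∑ i, ∑ j, 1 / 2 * (G.X i (G.X j v) g - G.X j (G.X i v) g) ^ 2 := by
      have e3 : ∑ i, ∑ j, (G.X i (G.X j v) g - G.X j (G.X i v) g) * G.X i (G.X j v) g
          = ∑ i, ∑ j, (G.X j (G.X i v) g - G.X i (G.X j v) g) * G.X j (G.X i v) g :=
        Finset.sum_comm
      have e4 : ∑ i, ∑ j, (G.X i (G.X j v) g - G.X j (G.X i v) g) * G.X i (G.X j v) g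
          + ∑ i, ∑ j, (G.X j (G.X i v) g - G.X i (G.X j v) g) * G.X j (G.X i v) g
          = 2 * ∑ i, ∑ j, 1 / 2 * (G.X i (G.X j v) g - G.X j (G.X i v) g) ^ 2 := by
        simp only [← Finset.sum_add_distrib, Finset.mul_sum]
        exact Finset.sum_congr rfl fun i _ => Finset.sum_congr rfl fun j _ => by ring
      linarith
    have e5 : ∑ i, ∑ j, G.X j v g * (G.X i (G.X i (G.X j v)) g - 2 * G.X i (G.X j (G.X i v)) g
        + G.X j (G.X i (G.X i v)) g) = 0 :=
      Finset.sum_eq_zero fun i _ => Finset.sum_eq_zero fun j _ => by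
        rw [G.X_double_commutator hv, mul_zero]
    rw [← sub_eq_zero] at e1 e2 ⊢
    rw [← e5, ← add_zero (∑ i, ∑ j, _ * (_ + _)), ← e1, ← add_zero (_ + (_ - _)), ← e2]
    simp only [← Finset.sum_sub_distrib, ← Finset.sum_add_distrib]
    exact Finset.sum_congr rfl fun i _ => Finset.sum_congr rfl fun j _ => by ring

/-- From [X_i, Z] = X_i, the derivative of Zv in 2 Zv ∇ᴴv yields Z|∇ᴴv|² + 2|∇ᴴv|². The first term
is cancelled by the divergence of |∇ᴴv|² Z, whose remainder is Q|∇ᴴv|² with Q the divergence of Z.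
-/
theorem isDivergence_rellich : IsDivergence G.rellichDiv G.rellichField where
  continuous_div := by
    have := G.continuous_jetX
    have := G.continuous_jetXX
    have := G.continuous_jetZ
    unfold rellichDiv jetLap jetNormSq
    fun_prop
  continuous_field := by
    have := G.continuous_jetX
    have := G.continuous_jetZ
    have := G.continuous_horField
    have : Continuous G.dilationField := G.dilationLin.continuous
    unfold rellichField jetNormSq
    fun_prop
  contDiff v hv := by
    have hX : ∀ i, ContDiff ℝ 1 (G.X i v) := fun i => contDiff_infty.1 (G.contDiff_X hv i) 1
    have hH := fun i => G.contDiff_horField i (n := 1)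
    have hZ := G.contDiff_dilation_deriv hv
    have hZ' : ContDiff ℝ 1 G.dilationField := G.dilationLin.contDiff
    simp only [rellichField, jetNormSq, G.jetX_smooth hv, G.jetZ_jet]
    fun_prop
  euclDiv_eq v hv g := by
    have hX := G.contDiff_X hv
    have dX := fun i => (hX i).differentiable (by simp) g
    have hZ : DifferentiableAt ℝ G.dilationField g := G.dilationLin.differentiableAt
    have dZ := (G.contDiff_dilation_deriv hv).differentiable one_ne_zero g
    simp only [rellichField, jetNormSq, G.jetX_smooth hv, G.jetZ_jet, sub_eq_add_neg,
      ← neg_smul]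
    have h1 : ∀ i, HasFDerivAt (fun x => 2 * fderiv ℝ v x (G.dilationField x) * G.X i v x) _ g :=
      fun i => (dZ.hasFDerivAt.const_mul 2).mul (dX i).hasFDerivAt
    have h2 : HasFDerivAt (fun x => -∑ i, G.X i v x ^ 2) _ g :=
      (HasFDerivAt.fun_sum fun i _ => (dX i).hasFDerivAt.pow 2).neg
    have hH := fun i => (G.hasFDerivAt_horField i g).differentiableAt
    rw [euclDiv_add (DifferentiableAt.fun_sum fun i _ => (h1 i).differentiableAt.fun_smul (hH i))
      (h2.differentiableAt.fun_smul hZ),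
      G.euclDiv_sum_smul_horField fun i => (h1 i).differentiableAt,
      euclDiv_smul h2.differentiableAt hZ, h2.fderiv]
    have hQ : euclDiv G.dilationField g = G.homDim := by
      rw [euclDiv, show G.dilationField = G.dilationLin from rfl, G.dilationLin.fderiv, homDim]
    have hXa : ∀ {w : 𝔤 → ℝ}, ContDiff ℝ (⊤ : ℕ∞) w → ∀ i, fderiv ℝ w g (G.horField i g)
        = G.X i w g := fun hw i => (G.X_apply hw i g).symm
    simp only [(h1 _).fderiv, hQ, sum_apply, neg_apply, add_apply, smul_apply, smul_eq_mul,
      G.X_dilation_commutator hv, hXa (hX _)]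
    simp only [rellichDiv, jetLap, jetNormSq, G.jetX_smooth hv, G.jetXX_smooth hv,
      G.jetZ_jet, Finset.mul_sum, neg_mul, Finset.sum_mul, ← Finset.sum_neg_distrib,
      ← Finset.sum_add_distrib]
    exact Finset.sum_congr rfl fun i _ => by ring

theorem isDivergence_energy : IsDivergence G.energyDiv G.energyField where
  continuous_div := by
    have := G.continuous_jetX
    have := G.continuous_jetXX
    unfold energyDiv jetLap jetNormSq
    fun_prop
  continuous_field := by
    have := G.continuous_jetX
    have := G.continuous_horField
    unfold energyField
    fun_prop
  contDiff v hv := by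
    have hX : ∀ i, ContDiff ℝ 1 (G.X i v) := fun i => contDiff_infty.1 (G.contDiff_X hv i) 1
    have hH := fun i => G.contDiff_horField i (n := 1)
    have hv1 := contDiff_infty.1 hv 1
    simp only [energyField, G.jetX_smooth hv]
    simp only [jet]
    fun_prop
  euclDiv_eq v hv g := by
    have hX := G.contDiff_X hv
    have dX := fun i => (hX i).differentiable (by simp) g
    have hv' := hv.differentiable (by simp) g
    have hXa : ∀ {w : 𝔤 → ℝ}, ContDiff ℝ (⊤ : ℕ∞) w → ∀ i, fderiv ℝ w g (G.horField i g)
        = G.X i w g := fun hw i => (G.X_apply hw i g).symm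
    have h1 : ∀ i, HasFDerivAt (fun x => v x * G.X i v x) _ g :=
      fun i => hv'.hasFDerivAt.mul (dX i).hasFDerivAt
    have hj : (jet v g).1 = v g := rfl
    have hE : ∀ x, G.energyField (x, jet v x) = ∑ i, (v x * G.X i v x) • G.horField i x :=
      fun x => by simp only [energyField, G.jetX_smooth hv]; rfl
    simp only [hE]
    rw [G.euclDiv_sum_smul_horField fun i => (h1 i).differentiableAt]
    simp only [(h1 _).fderiv, add_apply, smul_apply, smul_eq_mul, hXa (hX _), hXa hv]
    simp only [energyDiv, jetLap, jetNormSq, G.jetX_smooth hv, G.jetXX_smooth hv, hj,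
      Finset.mul_sum, ← Finset.sum_add_distrib]
    exact Finset.sum_congr rfl fun i _ => by ring

theorem inner_e_horField (i : Fin m) (g : 𝔤) : ⟪(G.e i : 𝔤), G.horField i g⟫_ℝ = 1 := by
  have h1 : ⟪(G.e i : 𝔤), (G.e i : 𝔤)⟫_ℝ = 1 := by
    rw [← Submodule.coe_inner, real_inner_self_eq_norm_sq, G.e.norm_eq_one, one_pow]
  have h2 : ⟪(G.e i : 𝔤), G.bracket g (G.e i : 𝔤)⟫_ℝ = 0 :=
    Submodule.isOrtho_iff_inner_eq.1 G.orthogonal _ (G.e i).2 _ (G.bracket_mem_V₂ _ _)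
  rw [horField, leftInv, inner_add_right, inner_smul_right, h1, h2, mul_zero, add_zero]

/-- Here X_i x_i = 1, so differentiating the weight x_i isolates u². This gives a Poincaré
inequality from a single horizontal coordinate. -/
theorem isDivergence_poincare (i : Fin m) :
    IsDivergence (G.poincareDiv i) (G.poincareField i) where
  continuous_div := by
    have := G.continuous_jetX
    unfold poincareDiv
    fun_prop
  continuous_field := by
    have := G.continuous_horField
    unfold poincareField
    fun_prop
  contDiff v hv := by
    have hH := fun i => G.contDiff_horField i (n := 1)
    have hv1 := contDiff_infty.1 hv 1
    have hx : ContDiff ℝ 1 fun g : 𝔤 => ⟪(G.e i : 𝔤), g⟫_ℝ := contDiff_const.inner ℝ contDiff_id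
    simp only [poincareField]
    simp only [jet]
    fun_prop
  euclDiv_eq v hv g := by
    have hv' := hv.differentiable (by simp) g
    have hx : HasFDerivAt (fun g : 𝔤 => ⟪(G.e i : 𝔤), g⟫_ℝ) (innerSL ℝ (G.e i : 𝔤)) g :=
      (innerSL ℝ (G.e i : 𝔤)).hasFDerivAt
    have h1 : HasFDerivAt (fun x => ⟪(G.e i : 𝔤), x⟫_ℝ * v x ^ 2) _ g :=
      hx.mul (hv'.hasFDerivAt.pow 2)
    simp only [poincareField, poincareDiv, G.jetX_smooth hv]
    simp only [jet]
    rw [G.euclDiv_smul_horField h1.differentiableAt, h1.fderiv]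
    simp only [add_apply, smul_apply, smul_eq_mul, innerSL_apply_apply, G.inner_e_horField,
      ← G.X_apply hv]
    ring

end StepTwoCarnot

/-! ### Rotation of a vector -/

section HalfTurn

variable {E : Type*} [NormedAddCommGroup E] [InnerProductSpace ℝ E]

/-- The image of `b` under the half-turn about the line spanned by `w`. -/
def halfTurn (w b : E) : E := (2 * ⟪b, w⟫_ℝ / ⟪w, w⟫_ℝ) • w - b

theorem inner_halfTurn_halfTurn {w : E} (hw : w ≠ 0) (b c : E) :
    ⟪halfTurn w b, halfTurn w c⟫_ℝ = ⟪b, c⟫_ℝ := by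
  have h : ⟪w, w⟫_ℝ ≠ 0 := inner_self_ne_zero.2 hw
  simp only [halfTurn, inner_sub_left, inner_sub_right, inner_smul_left, inner_smul_right,
    conj_trivial, real_inner_comm w c]
  rw [real_inner_comm c w, real_inner_comm w b]
  field_simp
  ring

/-- If `ν` is a unit vector orthogonal to `b`, the half-turn about the bisector of `ν` and `n`
maps `b` to a vector orthogonal to `n`. -/
theorem inner_halfTurn_eq_zero {ν n b : E} (hν : ‖ν‖ = 1) (hb : ⟪b, ν⟫_ℝ = 0)
    (hw : ‖n‖ • ν + n ≠ 0) : ⟪halfTurn (‖n‖ • ν + n) b, n⟫_ℝ = 0 := by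
  have h : ⟪‖n‖ • ν + n, ‖n‖ • ν + n⟫_ℝ ≠ 0 := inner_self_ne_zero.2 hw
  -- Both summands have length ‖n‖, so their sum makes the same angle with each.
  have h1 : ⟪‖n‖ • ν + n, ‖n‖ • ν + n⟫_ℝ = 2 * ⟪‖n‖ • ν + n, n⟫_ℝ := by
    simp only [inner_add_left, inner_add_right, inner_smul_left, inner_smul_right, conj_trivial,
      real_inner_self_eq_norm_sq, hν, real_inner_comm n ν]
    ring
  have h2 : ⟪b, ‖n‖ • ν + n⟫_ℝ = ⟪b, n⟫_ℝ := by
    rw [inner_add_right, inner_smul_right, hb, mul_zero, zero_add]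
  rw [halfTurn, inner_sub_left, inner_smul_left, h2, conj_trivial]
  rw [h1] at h ⊢
  have h3 := right_ne_zero_of_mul h
  field_simp
  ring

end HalfTurn

namespace StepTwoCarnot

variable {m : ℕ} {𝔤 : Type*} [NormedAddCommGroup 𝔤] [InnerProductSpace ℝ 𝔤] (G : StepTwoCarnot m 𝔤)

theorem leftInv_smul (c : ℝ) (ξ g : 𝔤) : G.leftInv (c • ξ) g = c • G.leftInv ξ g := by
  simp only [leftInv, map_smul, smul_add, smul_comm c (1 / 2 : ℝ)]

theorem leftInv_sum {ι : Type*} (s : Finset ι) (ξ : ι → 𝔤) (g : 𝔤) :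
    G.leftInv (∑ i ∈ s, ξ i) g = ∑ i ∈ s, G.leftInv (ξ i) g := by
  simp only [leftInv, map_sum, Finset.smul_sum, Finset.sum_add_distrib]

theorem sum_inner_smul_e {ξ : 𝔤} (hξ : ξ ∈ G.V₁) :
    ∑ i, ⟪(G.e i : 𝔤), ξ⟫_ℝ • (G.e i : 𝔤) = ξ := by
  have h := congrArg (Submodule.subtype G.V₁) (G.e.sum_repr' ⟨ξ, hξ⟩)
  simpa using h

theorem leftInv_eq_sum {ξ : 𝔤} (hξ : ξ ∈ G.V₁) (g : 𝔤) :
    G.leftInv ξ g = ∑ i, ⟪(G.e i : 𝔤), ξ⟫_ℝ • G.horField i g := by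
  conv_lhs => rw [← G.sum_inner_smul_e hξ, leftInv_sum]
  simp only [leftInv_smul, horField]

theorem inner_e_e (i j : Fin m) : ⟪(G.e i : 𝔤), (G.e j : 𝔤)⟫_ℝ = if i = j then 1 else 0 := by
  rw [← Submodule.coe_inner]
  exact orthonormal_iff_ite.1 G.e.orthonormal i j

variable [FiniteDimensional ℝ 𝔤]

/-! ### The horizontal normal -/

/-- The horizontal gradient of `φ`. -/
def horGrad (φ : 𝔤 → ℝ) (g : 𝔤) : 𝔤 := ∑ j, fderiv ℝ φ g (G.horField j g) • (G.e j : 𝔤)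

theorem horGrad_mem (φ : 𝔤 → ℝ) (g : 𝔤) : G.horGrad φ g ∈ G.V₁ :=
  Submodule.sum_mem _ fun j _ => Submodule.smul_mem _ _ (G.e j).2

theorem inner_e_horGrad (φ : 𝔤 → ℝ) (g : 𝔤) (i : Fin m) :
    ⟪(G.e i : 𝔤), G.horGrad φ g⟫_ℝ = fderiv ℝ φ g (G.horField i g) := by
  simp [horGrad, inner_sum, inner_smul_right, G.inner_e_e]

theorem inner_horGrad (φ : 𝔤 → ℝ) (g ξ : 𝔤) :
    ⟪ξ, G.horGrad φ g⟫_ℝ = ∑ j, ⟪ξ, (G.e j : 𝔤)⟫_ℝ * fderiv ℝ φ g (G.horField j g) := by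
  simp only [horGrad, inner_sum, inner_smul_right, mul_comm]

theorem fderiv_leftInv_eq (φ : 𝔤 → ℝ) {ξ : 𝔤} (hξ : ξ ∈ G.V₁) (g : 𝔤) :
    fderiv ℝ φ g (G.leftInv ξ g) = ⟪ξ, G.horGrad φ g⟫_ℝ := by
  rw [G.leftInv_eq_sum hξ, inner_horGrad]
  simp only [map_sum, map_smul, smul_eq_mul, real_inner_comm ξ]

theorem inner_grad (φ : 𝔤 → ℝ) (g ξ : 𝔤) :
    ⟪G.grad φ g, ξ⟫_ℝ = fderiv ℝ φ g (G.leftInv ξ g) := by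
  have h : ξ = ∑ a, ⟪stdOrthonormalBasis ℝ 𝔤 a, ξ⟫_ℝ • stdOrthonormalBasis ℝ 𝔤 a :=
    ((stdOrthonormalBasis ℝ 𝔤).sum_repr' ξ).symm
  conv_rhs => rw [h, leftInv_sum]
  simp only [grad, sum_inner, inner_smul_left, conj_trivial, leftInv_smul, map_sum, map_smul,
    smul_eq_mul, mul_comm]

theorem grad_ne_zero {φ : 𝔤 → ℝ} {g : 𝔤} (h : fderiv ℝ φ g ≠ 0) : G.grad φ g ≠ 0 := by
  intro h0
  refine h (ContinuousLinearMap.ext fun v => ?_)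
  have h1 := G.inner_grad φ g (v - (1 / 2 : ℝ) • G.bracket g v)
  have h2 : G.leftInv (v - (1 / 2 : ℝ) • G.bracket g v) g = v := by
    rw [leftInv, map_sub, map_smul, G.bracket_V₂ _ _ (G.bracket_mem_V₂ g v), smul_zero, sub_zero,
      sub_add_cancel]
  rw [h0, inner_zero_left, h2] at h1
  exact h1.symm

theorem horNormal_eq (φ : 𝔤 → ℝ) (g : 𝔤) :
    G.horNormal φ g = ‖G.grad φ g‖⁻¹ • G.horGrad φ g := by
  simp only [horNormal, normal, horGrad, inner_smul_left, conj_trivial, inner_grad,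
    Finset.smul_sum, smul_smul]
  rfl

theorem angle_eq (φ : 𝔤 → ℝ) (g : 𝔤) : G.angle φ g = ‖G.grad φ g‖⁻¹ * ‖G.horGrad φ g‖ := by
  rw [angle, horNormal_eq, norm_smul, norm_inv, norm_norm]

theorem gaussMap_eq {φ : 𝔤 → ℝ} {g : 𝔤} (h : fderiv ℝ φ g ≠ 0) :
    G.gaussMap φ g = ‖G.horGrad φ g‖⁻¹ • G.horGrad φ g := by
  have h1 : ‖G.grad φ g‖ ≠ 0 := norm_ne_zero_iff.2 (G.grad_ne_zero h)
  rw [gaussMap, angle_eq, horNormal_eq, smul_smul, mul_inv, inv_inv, mul_right_comm,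
    mul_inv_cancel₀ h1, one_mul]

theorem inner_dilationField_normal (φ : 𝔤 → ℝ) (g : 𝔤) :
    ⟪G.dilationField g, G.normal φ g⟫_ℝ
      = ‖G.grad φ g‖⁻¹ * fderiv ℝ φ g (G.dilationField g) := by
  rw [normal, inner_smul_right, real_inner_comm, inner_grad, leftInv_dilationField]

/-- Both sides of the star-shapedness condition carry the positive factor ‖∇φ‖⁻¹, which cancels. -/
theorem mul_norm_horGrad_le {φ : 𝔤 → ℝ} {g : 𝔤} {α : ℝ} (h : fderiv ℝ φ g ≠ 0)
    (hstar : α * G.angle φ g ≤ ⟪G.dilationField g, G.normal φ g⟫_ℝ) :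
    α * ‖G.horGrad φ g‖ ≤ fderiv ℝ φ g (G.dilationField g) := by
  have h1 : 0 < ‖G.grad φ g‖⁻¹ := inv_pos.2 (norm_pos_iff.2 (G.grad_ne_zero h))
  rw [angle_eq, inner_dilationField_normal, mul_left_comm] at hstar
  exact le_of_mul_le_mul_left hstar h1

theorem contDiff_horGrad {φ : 𝔤 → ℝ} (hφ : ContDiff ℝ 2 φ) : ContDiff ℝ 1 (G.horGrad φ) := by
  have h1 : ContDiff ℝ 1 (fderiv ℝ φ) := hφ.fderiv_right (by norm_num)
  have h2 := fun j => G.contDiff_horField j (n := 1)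
  unfold horGrad
  fun_prop

/-! ### The horizontal mean curvature -/

/-- The quadratic form of the horizontal Hessian. -/
def horHess (φ : 𝔤 → ℝ) (g a b : 𝔤) : ℝ :=
  ∑ i, ∑ j, ⟪(G.e i : 𝔤), a⟫_ℝ * ⟪(G.e j : 𝔤), b⟫_ℝ * G.jetXX i j (g, jet φ g)

theorem fderiv_X_leftInv {φ : 𝔤 → ℝ} (hφ : ContDiff ℝ 2 φ) {ξ : 𝔤} (hξ : ξ ∈ G.V₁) (g : 𝔤)
    (j : Fin m) :
    fderiv ℝ (fun x => fderiv ℝ φ x (G.horField j x)) g (G.leftInv ξ g)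
      = ∑ i, ⟪(G.e i : 𝔤), ξ⟫_ℝ * G.jetXX i j (g, jet φ g) := by
  have h2 : ContDiffAt ℝ 2 φ g := hφ.contDiffAt
  rw [G.leftInv_eq_sum hξ]
  simp only [map_sum, map_smul, smul_eq_mul]
  refine Finset.sum_congr rfl fun i _ => ?_
  rw [← G.X_X_eq_jetXX h2, G.X_eq_fderiv
    ((G.contDiffAt_X (n := 1) h2 h2 j).differentiableAt one_ne_zero),
    (G.X_eventuallyEq h2 j).fderiv_eq]

/-- Differentiating `⟪B, ∇ᴴφ⟫ = 0` along a horizontal direction. -/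
theorem inner_horConn_horGrad {φ : 𝔤 → ℝ} (hφ : ContDiff ℝ 2 φ) {g : 𝔤} {B : 𝔤 → 𝔤}
    (hB : DifferentiableAt ℝ B g) (hmem : B g ∈ G.V₁)
    (h0 : ∀ᶠ x in 𝓝 g, ⟪B x, G.horGrad φ x⟫_ℝ = 0) :
    ⟪G.horConn B B g, G.horGrad φ g⟫_ℝ = -G.horHess φ g (B g) (B g) := by
  have hn : ∀ j, DifferentiableAt ℝ (fun x => fderiv ℝ φ x (G.horField j x)) g := fun j =>
    (((hφ.fderiv_right (m := 1) (by norm_num)).clm_apply (G.contDiff_horField j)).differentiable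
      one_ne_zero) g
  have hBj : ∀ j, DifferentiableAt ℝ (fun x => ⟪B x, (G.e j : 𝔤)⟫_ℝ) g :=
    fun j => hB.inner ℝ (differentiableAt_const _)
  have h1 : HasFDerivAt (fun x => ∑ j, ⟪B x, (G.e j : 𝔤)⟫_ℝ * fderiv ℝ φ x (G.horField j x)) _ g :=
    HasFDerivAt.fun_sum fun j _ => (hBj j).hasFDerivAt.mul (hn j).hasFDerivAt
  have h2 : (fun x => ∑ j, ⟪B x, (G.e j : 𝔤)⟫_ℝ * fderiv ℝ φ x (G.horField j x)) =ᶠ[𝓝 g]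
      fun _ => 0 := by
    filter_upwards [h0] with x hx
    rw [← inner_horGrad, hx]
  have h3 := congrArg (fun L : 𝔤 →L[ℝ] ℝ => L (G.leftInv (B g) g)) (h2.fderiv_eq.symm.trans h1.fderiv)
  simp only [fderiv_fun_const, Pi.zero_apply, zero_apply, sum_apply, add_apply, smul_apply,
    smul_eq_mul, G.fderiv_X_leftInv hφ hmem, Finset.sum_add_distrib] at h3
  rw [horConn, sum_inner, horHess, Finset.sum_comm]
  simp only [inner_smul_left, conj_trivial, inner_e_horGrad]
  rw [eq_neg_iff_add_eq_zero, add_comm, h3]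
  congr 1
  · refine Finset.sum_congr rfl fun j _ => ?_
    rw [Finset.mul_sum]
    refine Finset.sum_congr rfl fun i _ => ?_
    rw [real_inner_comm (G.e j : 𝔤)]
    ring
  · exact Finset.sum_congr rfl fun j _ => mul_comm _ _

/-- The trace of a bilinear form is independent of the orthonormal basis. It allows the Laplacian to
be computed in a basis adapted to the horizontal normal. -/
theorem sum_horHess_eq {ι : Type*} [Fintype ι] (b : OrthonormalBasis ι ℝ G.V₁) (φ : 𝔤 → ℝ)
    (g : 𝔤) : ∑ o, G.horHess φ g (b o) (b o) = G.jetLap (g, jet φ g) := by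
  have h : ∀ i j, ∑ o, ⟪(G.e i : 𝔤), (b o : 𝔤)⟫_ℝ * ⟪(G.e j : 𝔤), (b o : 𝔤)⟫_ℝ
      = if i = j then 1 else 0 := by
    intro i j
    rw [← G.inner_e_e, ← Submodule.coe_inner, ← b.sum_inner_mul_inner]
    refine Finset.sum_congr rfl fun o _ => ?_
    rw [Submodule.coe_inner, Submodule.coe_inner, real_inner_comm (G.e j : 𝔤)]
  simp only [horHess]
  rw [Finset.sum_comm]
  simp only [Finset.sum_comm (s := (Finset.univ : Finset ι)), ← Finset.sum_mul, h]
  simp [jetLap]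

/-- The index `none` carries the normal and the remaining indices `Fin (m - 1)` match those of the
tangent frames in `IsHorMeanCurvature`. A unit vector in V₁ forces m > 0, so the truncated
subtraction is harmless. -/
theorem exists_orthonormalBasis_option {ν : 𝔤} (hν : ν ∈ G.V₁) (h1 : ‖ν‖ = 1) :
    ∃ b : OrthonormalBasis (Option (Fin (m - 1))) ℝ G.V₁, (b none : 𝔤) = ν := by
  have hm : 0 < m := by
    rcases Nat.eq_zero_or_pos m with h | h
    · subst h
      have h2 := G.sum_inner_smul_e hν
      simp only [Finset.univ_eq_empty, Finset.sum_empty] at h2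
      rw [← h2] at h1
      simp at h1
    · exact h
  have hcard : Module.finrank ℝ G.V₁ = Fintype.card (Option (Fin (m - 1))) := by
    rw [Module.finrank_eq_card_basis G.e.toBasis]
    simp only [Fintype.card_fin, Fintype.card_option]
    omega
  obtain ⟨b, hb⟩ := Orthonormal.exists_orthonormalBasis_extension_of_card_eq hcard
    (v := fun _ => (⟨ν, hν⟩ : G.V₁)) (s := {none}) (by
      rw [orthonormal_iff_ite]
      rintro ⟨i, hi⟩ ⟨j, hj⟩
      rw [Set.mem_singleton_iff] at hi hj
      subst hi hj
      simp [h1])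
  exact ⟨b, by rw [hb none rfl]⟩

/-- The horizontal mean curvature of a level set in terms of the horizontal Hessian. -/
theorem isHorMeanCurvature_horHess {Ω : Set 𝔤} {φ : 𝔤 → ℝ} (hφ : ContDiff ℝ 2 φ) {g : 𝔤}
    (hd : fderiv ℝ φ g ≠ 0) (hn : G.horGrad φ g ≠ 0) :
    G.IsHorMeanCurvature Ω φ g (-(‖G.horGrad φ g‖⁻¹ * (G.jetLap (g, jet φ g)
      - G.horHess φ g (‖G.horGrad φ g‖⁻¹ • G.horGrad φ g)
        (‖G.horGrad φ g‖⁻¹ • G.horGrad φ g)))) := by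
  set ν : 𝔤 := ‖G.horGrad φ g‖⁻¹ • G.horGrad φ g with hνdef
  have hn' : ‖G.horGrad φ g‖ ≠ 0 := norm_ne_zero_iff.2 hn
  have hν1 : ‖ν‖ = 1 := by rw [hνdef, norm_smul, norm_inv, norm_norm, inv_mul_cancel₀ hn']
  have hνm : ν ∈ G.V₁ := Submodule.smul_mem _ _ (G.horGrad_mem φ g)
  obtain ⟨b, hb⟩ := G.exists_orthonormalBasis_option hνm hν1
  have hbν : ∀ k, ⟪(b (some k) : 𝔤), ν⟫_ℝ = 0 := fun k => by
    rw [← hb, ← Submodule.coe_inner]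
    exact b.orthonormal.2 (by simp)
  -- The curvature hypothesis speaks of values attained by some frame, so a C¹ frame must be
  -- produced. Half-turns about w(x), which bisects ν and ∇ᴴφ(x), carry the fixed basis of the
  -- complement of ν to one orthogonal to ∇ᴴφ(x). They are C¹ near g since w(g) is a nonzero
  -- multiple of ν.
  set w : 𝔤 → 𝔤 := fun x => ‖G.horGrad φ x‖ • ν + G.horGrad φ x with hw
  have hgc := G.contDiff_horGrad hφ
  have hwg : w g = (2 * ‖G.horGrad φ g‖) • ν := by
    rw [hw, hνdef]
    simp only [smul_smul]
    rw [mul_inv_cancel₀ hn', mul_assoc, mul_inv_cancel₀ hn', one_smul, mul_one, two_smul]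
  have hν0 : ν ≠ 0 := norm_ne_zero_iff.1 (by rw [hν1]; exact one_ne_zero)
  have hwg0 : w g ≠ 0 := by
    rw [hwg]
    exact smul_ne_zero (mul_ne_zero two_ne_zero hn') hν0
  have hwd : ContDiffAt ℝ 1 w g :=
    ((hgc.contDiffAt.norm ℝ hn).smul contDiffAt_const).add hgc.contDiffAt
  have hw0 : ∀ᶠ x in 𝓝 g, w x ≠ 0 := hwd.continuousAt.eventually_ne hwg0
  have hE : ∀ k, ContDiffAt ℝ 1 (fun x => halfTurn (w x) (b (some k) : 𝔤)) g := by
    intro k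
    have h2 : ⟪w g, w g⟫_ℝ ≠ 0 := inner_self_ne_zero.2 hwg0
    unfold halfTurn
    exact ((((contDiffAt_const (c := (2 : ℝ))).mul (contDiffAt_const.inner ℝ hwd)).div
      (hwd.inner ℝ hwd) h2).smul hwd).sub contDiffAt_const
  have hEV : ∀ k x, halfTurn (w x) (b (some k) : 𝔤) ∈ G.V₁ := fun k x =>
    Submodule.sub_mem _ (Submodule.smul_mem _ _ (Submodule.add_mem _ (Submodule.smul_mem _ _ hνm)
      (G.horGrad_mem φ x))) (b (some k)).2
  have hEn : ∀ k, ∀ x, w x ≠ 0 → ⟪halfTurn (w x) (b (some k) : 𝔤), G.horGrad φ x⟫_ℝ = 0 :=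
    fun k x hx => inner_halfTurn_eq_zero hν1 (hbν k) hx
  -- At g the axis is ν itself, so the basis is reversed; the sign disappears in the quadratic form.
  have hEg : ∀ k, halfTurn (w g) (b (some k) : 𝔤) = -(b (some k) : 𝔤) := fun k => by
    rw [halfTurn, hwg, inner_smul_right, hbν, mul_zero, mul_zero, zero_div, zero_smul, zero_sub]
  refine ⟨fun k x => halfTurn (w x) (b (some k)), hE, ?_, ?_⟩
  · filter_upwards [nhdsWithin_le_nhds hw0] with x hx
    refine ⟨?_, fun k => ⟨hEV k x, ?_⟩⟩
    · rw [orthonormal_iff_ite]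
      intro k l
      rw [inner_halfTurn_halfTurn hx, ← Submodule.coe_inner,
        orthonormal_iff_ite.1 b.orthonormal]
      simp
    · rw [G.fderiv_leftInv_eq φ (hEV k x), hEn k x hx]
  · rw [G.gaussMap_eq hd]
    have hk : ∀ k, ⟪G.horConn (fun x => halfTurn (w x) (b (some k) : 𝔤))
        (fun x => halfTurn (w x) (b (some k) : 𝔤)) g, ‖G.horGrad φ g‖⁻¹ • G.horGrad φ g⟫_ℝ
        = -(‖G.horGrad φ g‖⁻¹ * G.horHess φ g (b (some k)) (b (some k))) := by
      intro k
      rw [inner_smul_right, G.inner_horConn_horGrad hφ ((hE k).differentiableAt one_ne_zero)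
        (hEV k g) (hw0.mono fun x hx => hEn k x hx), hEg]
      simp only [horHess, inner_neg_right, neg_mul_neg]
      ring
    simp only [hk]
    rw [Finset.sum_neg_distrib, ← Finset.mul_sum, ← G.sum_horHess_eq b, Fintype.sum_option, hb,
      add_sub_cancel_left]

/-- The bound on the horizontal mean curvature in terms of the defining function. -/
theorem abs_norm_sq_mul_lap_sub_horHess_le {Ω : Set 𝔤} {φ : 𝔤 → ℝ} (hφ : ContDiff ℝ 2 φ) {g : 𝔤}
    (hd : fderiv ℝ φ g ≠ 0) {M : ℝ}
    (hcurv : G.angle φ g ≠ 0 → ∀ h, G.IsHorMeanCurvature Ω φ g h → |h| ≤ M) :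
    |‖G.horGrad φ g‖ ^ 2 * G.jetLap (g, jet φ g) - G.horHess φ g (G.horGrad φ g) (G.horGrad φ g)|
      ≤ M * ‖G.horGrad φ g‖ ^ 3 := by
  -- At a characteristic point both sides vanish, so the bound holds on the whole boundary although
  -- curvature is defined only off the characteristic set.
  by_cases hn : G.horGrad φ g = 0
  · simp [hn, horHess]
  have hn' : 0 < ‖G.horGrad φ g‖ := norm_pos_iff.2 hn
  have h := hcurv (by
    rw [angle_eq]
    exact mul_ne_zero (inv_ne_zero (norm_ne_zero_iff.2 (G.grad_ne_zero hd))) hn'.ne') _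
    (G.isHorMeanCurvature_horHess hφ hd hn)
  have hs : ∀ c : ℝ, G.horHess φ g (c • G.horGrad φ g) (c • G.horGrad φ g)
      = c ^ 2 * G.horHess φ g (G.horGrad φ g) (G.horGrad φ g) := by
    intro c
    simp only [horHess, inner_smul_right, Finset.mul_sum]
    exact Finset.sum_congr rfl fun i _ => Finset.sum_congr rfl fun j _ => by ring
  rw [hs] at h
  have h1 : ‖G.horGrad φ g‖ ^ 2 * G.jetLap (g, jet φ g)
      - G.horHess φ g (G.horGrad φ g) (G.horGrad φ g)
      = -(-(‖G.horGrad φ g‖⁻¹ * (G.jetLap (g, jet φ g)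
        - ‖G.horGrad φ g‖⁻¹ ^ 2 * G.horHess φ g (G.horGrad φ g) (G.horGrad φ g))))
        * ‖G.horGrad φ g‖ ^ 3 := by
    field_simp
  rw [h1, abs_mul, abs_neg, abs_of_nonneg (pow_nonneg hn'.le 3)]
  exact mul_le_mul_of_nonneg_right h (by positivity)

end StepTwoCarnot

/-! ### The second elementary symmetric function and the bound on Zu -/

theorem Finset.sum_sq_eq_sum_powersetCard_two {ι : Type*} [DecidableEq ι] (t : Finset ι)
    (f : ι → ℝ) : (∑ i ∈ t, f i) ^ 2
      = ∑ i ∈ t, f i ^ 2 + 2 * ∑ s ∈ t.powersetCard 2, ∏ i ∈ s, f i := by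
  induction t using Finset.induction_on with
  | empty =>
    rw [Finset.powersetCard_eq_empty.2 (by rw [Finset.card_empty]; exact two_pos)]
    simp
  | insert a t ha ih =>
    rw [Finset.sum_insert ha, Finset.sum_insert ha, Finset.powersetCard_succ_insert ha,
      Finset.sum_union, Finset.sum_image]
    · have h : ∑ s ∈ t.powersetCard 1, ∏ i ∈ insert a s, f i = f a * ∑ i ∈ t, f i := by
        rw [Finset.powersetCard_one, Finset.sum_map, Finset.mul_sum]
        refine Finset.sum_congr rfl fun i hi => ?_
        have : a ∉ ({i} : Finset ι) := by
          rw [Finset.mem_singleton]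
          rintro rfl
          exact ha hi
        change ∏ k ∈ insert a {i}, f k = _
        rw [Finset.prod_insert this, Finset.prod_singleton]
      rw [h, add_sq, ih]
      ring
    · intro x hx y hy hxy
      have hx' : a ∉ x := fun h => ha ((Finset.mem_powersetCard.1 hx).1 h)
      have hy' : a ∉ y := fun h => ha ((Finset.mem_powersetCard.1 hy).1 h)
      rw [← Finset.erase_insert hx', hxy, Finset.erase_insert hy']
    · rw [Finset.disjoint_left]
      intro x hx hx'
      obtain ⟨y, -, rfl⟩ := Finset.mem_image.1 hx'
      exact ha ((Finset.mem_powersetCard.1 hx).1 (Finset.mem_insert_self a y))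

/-- Both sides are the trace of A². It is used to express F₂ by the entries of the symmetrized
Hessian. -/
theorem Matrix.IsHermitian.sum_eigenvalues_sq {n : Type*} [Fintype n] [DecidableEq n]
    {A : Matrix n n ℝ} (hA : A.IsHermitian) :
    ∑ i, hA.eigenvalues i ^ 2 = ∑ i, ∑ j, A i j ^ 2 := by
  have h : (A * A).trace = ∑ i, hA.eigenvalues i ^ 2 := by
    conv_lhs => rw [hA.spectral_theorem, ← map_mul, Matrix.diagonal_mul_diagonal,
      Unitary.conjStarAlgAut_apply, Matrix.trace_mul_cycle, Unitary.coe_star_mul_self, one_mul,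
      Matrix.trace_diagonal]
    simp [pow_two]
  rw [← h]
  simp only [Matrix.trace, Matrix.diag, Matrix.mul_apply]
  refine Finset.sum_congr rfl fun i _ => Finset.sum_congr rfl fun j _ => ?_
  have : A j i = A i j := by simpa using hA.apply i j
  rw [this, pow_two]

namespace StepTwoCarnot

variable {m : ℕ} {𝔤 : Type*} [NormedAddCommGroup 𝔤] [InnerProductSpace ℝ 𝔤]
  [FiniteDimensional ℝ 𝔤] (G : StepTwoCarnot m 𝔤)

/-- The sum of the squares of the commutators. -/
def jetTSq (p : 𝔤 × Jet 𝔤) : ℝ := ∑ i, ∑ j, G.jetT i j p ^ 2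

/-- `hessianDiv` is `2 F₂[u] + 3/4 ∑ ([X_i, X_j] u)²`. -/
theorem hessianDiv_eq {u : 𝔤 → ℝ} {g : 𝔤} (hu : ContDiffAt ℝ 2 u g) :
    G.hessianDiv (g, jet u g) = 2 * G.hessianOp 2 u g + 3 / 4 * G.jetTSq (g, jet u g) := by
  have hA := G.symHess_isHermitian u g
  have h1 : ∑ i, hA.eigenvalues i = G.jetLap (g, jet u g) := by
    have := hA.trace_eq_sum_eigenvalues
    simp only [RCLike.ofReal_real_eq_id, id] at this
    rw [← this]
    simp only [Matrix.trace, Matrix.diag, symHess, Matrix.of_apply, jetLap, G.X_X_eq_jetXX hu]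
    exact Finset.sum_congr rfl fun i _ => by ring
  have h2 := hA.sum_eigenvalues_sq
  have h3 := Finset.sum_sq_eq_sum_powersetCard_two Finset.univ hA.eigenvalues
  rw [h1, h2] at h3
  have h4 : G.hessianOp 2 u g
      = ∑ s ∈ Finset.powersetCard 2 Finset.univ, ∏ i ∈ s, hA.eigenvalues i := rfl
  rw [← h4] at h3
  have h5 : 2 * G.hessianOp 2 u g
      = G.jetLap (g, jet u g) ^ 2 - ∑ i, ∑ j, G.symHess u g i j ^ 2 := by linarith
  rw [h5, hessianDiv, jetTSq, pow_two, jetLap, Finset.sum_mul_sum, Finset.mul_sum]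
  simp only [Finset.mul_sum, ← Finset.sum_sub_distrib, ← Finset.sum_add_distrib]
  refine Finset.sum_congr rfl fun i _ => Finset.sum_congr rfl fun j _ => ?_
  rw [← G.jetXX_sub hu, symHess, Matrix.of_apply, G.X_X_eq_jetXX hu, G.X_X_eq_jetXX hu]
  ring

/-! ### Bound of the dilation field -/

/-- The brackets of the basis span V₂, so the map from coefficient arrays to combinations of
brackets has a linear right inverse on its range. In finite dimension it is bounded, which gives B.
-/
theorem exists_commutator_coef : ∃ B : ℝ, 0 ≤ B ∧ ∀ g : 𝔤, ∃ y : Fin m → Fin m → ℝ,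
    G.V₂.starProjection g = ∑ i, ∑ j, y i j • G.bracket (G.e i : 𝔤) (G.e j) ∧
      ∀ i j, |y i j| ≤ B * ‖g‖ := by
  let Ψ : (Fin m × Fin m → ℝ) →ₗ[ℝ] 𝔤 :=
    Fintype.linearCombination ℝ fun q : Fin m × Fin m => G.bracket (G.e q.1 : 𝔤) (G.e q.2)
  have hΨ : G.V₂ ≤ LinearMap.range Ψ := by
    rw [← G.bracket_V₁_V₁, Submodule.span_le]
    rintro _ ⟨x, hx, y, hy, rfl⟩
    refine ⟨fun q => ⟪(G.e q.1 : 𝔤), x⟫_ℝ * ⟪(G.e q.2 : 𝔤), y⟫_ℝ, ?_⟩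
    conv_rhs => rw [← G.sum_inner_smul_e hx, ← G.sum_inner_smul_e hy]
    simp only [Ψ, Fintype.linearCombination_apply, Fintype.sum_prod_type, map_sum, map_smul,
      LinearMap.sum_apply, LinearMap.smul_apply, Finset.smul_sum, smul_smul]
    rw [Finset.sum_comm]
    simp only [mul_comm]
  obtain ⟨r, hr⟩ := Ψ.rangeRestrict.exists_rightInverse_of_surjective Ψ.range_rangeRestrict
  let P : 𝔤 →ₗ[ℝ] LinearMap.range Ψ := LinearMap.codRestrict _ (G.V₂.starProjection : 𝔤 →ₗ[ℝ] 𝔤)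
    fun g => hΨ (Submodule.starProjection_apply_mem _ _)
  let Λ : 𝔤 →L[ℝ] (Fin m × Fin m → ℝ) := LinearMap.toContinuousLinearMap (r ∘ₗ P)
  refine ⟨‖Λ‖, norm_nonneg _, fun g => ⟨fun i j => Λ g (i, j), ?_, fun i j => ?_⟩⟩
  · have h1 : Ψ (Λ g) = G.V₂.starProjection g := by
      have := congrArg (fun L => ((L (P g) : LinearMap.range Ψ) : 𝔤)) hr
      exact this
    rw [← h1]
    simp only [Ψ, Fintype.linearCombination_apply, Fintype.sum_prod_type]
  · exact (norm_le_pi_norm (Λ g) (i, j)).trans (Λ.le_opNorm g)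

/-- The bracket corrections in ∑ x_i X_i add up to half of [g, x] with x the horizontal part of g,
and this bracket is zero. -/
theorem starProjection_V₁_eq_sum (g : 𝔤) :
    G.V₁.starProjection g = ∑ i, ⟪(G.e i : 𝔤), g⟫_ℝ • G.horField i g := by
  have hm := Submodule.starProjection_apply_mem G.V₁ g
  have h1 : ∀ i, ⟪(G.e i : 𝔤), G.V₁.starProjection g⟫_ℝ = ⟪(G.e i : 𝔤), g⟫_ℝ := fun i => by
    conv_rhs => rw [← G.starProjection_add g, inner_add_right]
    rw [Submodule.isOrtho_iff_inner_eq.1 G.orthogonal _ (G.e i).2 _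
      (Submodule.starProjection_apply_mem _ _), add_zero]
  have h2 : G.bracket g (G.V₁.starProjection g) = 0 := by
    have h3 := G.bracket_self g
    nth_rewrite 2 [← G.starProjection_add g] at h3
    rwa [map_add, G.bracket_V₂ _ _ (Submodule.starProjection_apply_mem _ _), add_zero] at h3
  have h4 := G.leftInv_eq_sum hm g
  rw [leftInv, h2, smul_zero, add_zero] at h4
  simpa only [h1] using h4

/-- On bounded sets `(Zu)²` is controlled by the derivatives `X_i u` and `[X_i, X_j] u`. -/
theorem exists_jetZ_sq_le (R : ℝ) : ∃ K : ℝ, 0 < K ∧ ∀ p : 𝔤 × Jet 𝔤, ‖p.1‖ ≤ R →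
    G.jetZ p ^ 2 ≤ K * (G.jetNormSq p + G.jetTSq p) := by
  obtain ⟨B, hB, h⟩ := G.exists_commutator_coef
  -- Cauchy-Schwarz on the two parts of Zu = a + 2b, with (a + 2b)² ≤ 2a² + 8b². The summand 1 makes
  -- K positive, since the final estimate divides by K.
  refine ⟨2 * (m * R ^ 2) + 8 * (m * (m * (B * R) ^ 2)) + 1, by positivity, fun p hp => ?_⟩
  obtain ⟨y, hy, hyB⟩ := h p.1
  have hR : 0 ≤ R := (norm_nonneg _).trans hp
  have hZ : G.jetZ p = ∑ i, ⟪(G.e i : 𝔤), p.1⟫_ℝ * G.jetX i p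
      + 2 * ∑ q : Fin m × Fin m, y q.1 q.2 * G.jetT q.1 q.2 p := by
    rw [jetZ, dilationField, starProjection_V₁_eq_sum, hy, Fintype.sum_prod_type]
    simp only [inner_add_right, inner_sum, inner_smul_right]
    rfl
  have c1 := Finset.sum_mul_sq_le_sq_mul_sq Finset.univ
    (fun i => ⟪(G.e i : 𝔤), p.1⟫_ℝ) (fun i => G.jetX i p)
  have c2 := Finset.sum_mul_sq_le_sq_mul_sq Finset.univ
    (fun q : Fin m × Fin m => y q.1 q.2) (fun q => G.jetT q.1 q.2 p)
  have b1 : ∑ i, ⟪(G.e i : 𝔤), p.1⟫_ℝ ^ 2 ≤ m * R ^ 2 := by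
    calc ∑ i, ⟪(G.e i : 𝔤), p.1⟫_ℝ ^ 2 ≤ ∑ _i : Fin m, R ^ 2 := by
          refine Finset.sum_le_sum fun i _ => ?_
          rw [← sq_abs]
          refine pow_le_pow_left₀ (abs_nonneg _) ?_ 2
          have h1 : ‖(G.e i : 𝔤)‖ = 1 := G.e.norm_eq_one i
          have h2 := abs_real_inner_le_norm (G.e i : 𝔤) p.1
          rw [h1, one_mul] at h2
          exact h2.trans hp
      _ = m * R ^ 2 := by simp
  have b2 : ∑ q : Fin m × Fin m, y q.1 q.2 ^ 2 ≤ m * (m * (B * R) ^ 2) := by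
    calc ∑ q : Fin m × Fin m, y q.1 q.2 ^ 2 ≤ ∑ _q : Fin m × Fin m, (B * R) ^ 2 := by
          refine Finset.sum_le_sum fun q _ => ?_
          rw [← sq_abs]
          exact pow_le_pow_left₀ (abs_nonneg _)
            ((hyB _ _).trans (mul_le_mul_of_nonneg_left hp hB)) 2
      _ = m * (m * (B * R) ^ 2) := by simp [mul_assoc]
  have e1 : ∑ q : Fin m × Fin m, G.jetT q.1 q.2 p ^ 2 = G.jetTSq p := by
    rw [Fintype.sum_prod_type, jetTSq]
  have n1 : 0 ≤ G.jetNormSq p := Finset.sum_nonneg fun i _ => sq_nonneg _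
  have n2 : 0 ≤ G.jetTSq p := Finset.sum_nonneg fun i _ => Finset.sum_nonneg fun j _ => sq_nonneg _
  rw [e1] at c2
  have d1 : _ ≤ m * R ^ 2 * G.jetNormSq p := c1.trans (mul_le_mul_of_nonneg_right b1 n1)
  have d2 := c2.trans (mul_le_mul_of_nonneg_right b2 n2)
  rw [hZ]
  set a := ∑ i, ⟪(G.e i : 𝔤), p.1⟫_ℝ * G.jetX i p
  set b := ∑ q : Fin m × Fin m, y q.1 q.2 * G.jetT q.1 q.2 p
  have c3 : (a + 2 * b) ^ 2 ≤ 2 * a ^ 2 + 8 * b ^ 2 := by nlinarith [sq_nonneg (a - 2 * b)]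
  have p1 : 0 ≤ (m : ℝ) * R ^ 2 := by positivity
  have p2 : 0 ≤ (m : ℝ) * (m * (B * R) ^ 2) := by positivity
  nlinarith [mul_nonneg p1 n2, mul_nonneg p2 n1]

end StepTwoCarnot

namespace StepTwoCarnot

variable {m : ℕ} {𝔤 : Type*} [NormedAddCommGroup 𝔤] [InnerProductSpace ℝ 𝔤]
  [FiniteDimensional ℝ 𝔤] (G : StepTwoCarnot m 𝔤)

/-! ### Boundary values -/

theorem jetT_neg (i j : Fin m) (p : 𝔤 × Jet 𝔤) : G.jetT j i p = -G.jetT i j p := by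
  rw [jetT, jetT, G.bracket_skew, inner_neg_right]

/-- Symmetrizing in i and j cancels the commutator parts and leaves the Euclidean Hessian on n_i X_j
- n_j X_i. With n_i = X_i φ these vectors are tangent to the boundary, so only tangential second
derivatives enter. -/
theorem sum_sq_mul_jetXX_sub (n : Fin m → ℝ) (p : 𝔤 × Jet 𝔤) :
    ∑ i, ∑ j, (n i ^ 2 * G.jetXX j j p - n i * n j * G.jetXX j i p)
      = 1 / 2 * ∑ i, ∑ j, ⟪p.2.2.2 (n i • G.horField j p.1 - n j • G.horField i p.1),
        n i • G.horField j p.1 - n j • G.horField i p.1⟫_ℝ := by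
  have hT : ∀ i, G.jetT i i p = 0 := fun i => by
    have := G.jetT_neg i i p
    linarith
  have h1 : ∀ i j, ⟪p.2.2.2 (n i • G.horField j p.1 - n j • G.horField i p.1),
      n i • G.horField j p.1 - n j • G.horField i p.1⟫_ℝ
      = (n i ^ 2 * G.jetXX j j p - n i * n j * G.jetXX j i p)
        + (n j ^ 2 * G.jetXX i i p - n j * n i * G.jetXX i j p) := by
    intro i j
    simp only [jetXX, hT, G.jetT_neg i j, map_sub, map_smul, inner_sub_left, inner_sub_right,
      inner_smul_left, inner_smul_right, conj_trivial]
    ring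
  have h2 : ∑ i, ∑ j, (n j ^ 2 * G.jetXX i i p - n j * n i * G.jetXX i j p)
      = ∑ i, ∑ j, (n i ^ 2 * G.jetXX j j p - n i * n j * G.jetXX j i p) := Finset.sum_comm
  simp only [h1, Finset.sum_add_distrib, h2]
  ring

section

variable {φ : 𝔤 → ℝ} {g : 𝔤} {J : Jet 𝔤} {c : ℝ}

theorem jetX_frontier (hJ : J.2.1 = c • gradient φ g) (i : Fin m) :
    G.jetX i (g, J) = c * fderiv ℝ φ g (G.horField i g) := by
  rw [jetX, hJ, inner_smul_left, inner_gradient_eq, conj_trivial]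

theorem norm_horGrad_sq (φ : 𝔤 → ℝ) (g : 𝔤) :
    ‖G.horGrad φ g‖ ^ 2 = ∑ i, fderiv ℝ φ g (G.horField i g) ^ 2 := by
  rw [← real_inner_self_eq_norm_sq, inner_horGrad]
  refine Finset.sum_congr rfl fun i _ => ?_
  rw [real_inner_comm, inner_e_horGrad, pow_two]

theorem fderiv_rellichField (hJ : J.2.1 = c • gradient φ g) :
    fderiv ℝ φ g (G.rellichField (g, J))
      = c ^ 2 * ‖G.horGrad φ g‖ ^ 2 * fderiv ℝ φ g (G.dilationField g) := by
  have hZ : G.jetZ (g, J) = c * fderiv ℝ φ g (G.dilationField g) := by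
    rw [jetZ, hJ, inner_smul_left, inner_gradient_eq, conj_trivial]
  simp only [rellichField, jetNormSq, hZ, G.jetX_frontier hJ, map_sub, map_sum, map_smul,
    smul_eq_mul, norm_horGrad_sq]
  simp only [Finset.mul_sum, Finset.sum_mul, ← Finset.sum_sub_distrib]
  exact Finset.sum_congr rfl fun i _ => by ring

/-- The commutator term is antisymmetric and contracts to zero with n_i n_j. In the rest only
tangential second derivatives remain, and these are c times those of φ, so u enters only through c².
-/
theorem fderiv_hessianField (hJ : J.2.1 = c • gradient φ g)
    (hH : ∀ τ, fderiv ℝ φ g τ = 0 →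
      ⟪J.2.2 τ, τ⟫_ℝ = c * ⟪fderiv ℝ (gradient φ) g τ, τ⟫_ℝ) :
    fderiv ℝ φ g (G.hessianField (g, J)) = c ^ 2 * (‖G.horGrad φ g‖ ^ 2 * G.jetLap (g, jet φ g)
      - G.horHess φ g (G.horGrad φ g) (G.horGrad φ g)) := by
  set n : Fin m → ℝ := fun i => fderiv ℝ φ g (G.horField i g) with hn
  have h1 : fderiv ℝ φ g (G.hessianField (g, J))
      = c * ∑ i, ∑ j, (n i ^ 2 * G.jetXX j j (g, J) - n i * n j * G.jetXX j i (g, J))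
        + c * ∑ i, ∑ j, G.jetT i j (g, J) * n i * n j := by
    simp only [hessianField, hessianCoef, G.jetX_frontier hJ, map_sum, map_smul, smul_eq_mul,
      Finset.mul_sum, Finset.sum_mul, ← Finset.sum_add_distrib]
    exact Finset.sum_congr rfl fun i _ => Finset.sum_congr rfl fun j _ => by ring
  have h2 : ∑ i, ∑ j, G.jetT i j (g, J) * n i * n j = 0 := by
    have h3 : ∑ i, ∑ j, G.jetT i j (g, J) * n i * n j
        = ∑ i, ∑ j, G.jetT j i (g, J) * n j * n i := Finset.sum_comm
    have h4 : ∑ i, ∑ j, G.jetT j i (g, J) * n j * n i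
        = -∑ i, ∑ j, G.jetT i j (g, J) * n i * n j := by
      simp only [← Finset.sum_neg_distrib]
      refine Finset.sum_congr rfl fun i _ => Finset.sum_congr rfl fun j _ => ?_
      rw [G.jetT_neg i j]
      ring
    linarith
  have h5 : ∑ i, ∑ j, (n i ^ 2 * G.jetXX j j (g, J) - n i * n j * G.jetXX j i (g, J))
      = c * ∑ i, ∑ j, (n i ^ 2 * G.jetXX j j (g, jet φ g)
        - n i * n j * G.jetXX j i (g, jet φ g)) := by
    rw [sum_sq_mul_jetXX_sub, sum_sq_mul_jetXX_sub]
    simp only [Finset.mul_sum]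
    refine Finset.sum_congr rfl fun i _ => Finset.sum_congr rfl fun j _ => ?_
    rw [hH _ (by simp only [map_sub, map_smul, smul_eq_mul, hn]; ring), jet]
    ring
  have h6 : ∑ i, ∑ j, (n i ^ 2 * G.jetXX j j (g, jet φ g) - n i * n j * G.jetXX j i (g, jet φ g))
      = ‖G.horGrad φ g‖ ^ 2 * G.jetLap (g, jet φ g)
        - G.horHess φ g (G.horGrad φ g) (G.horGrad φ g) := by
    simp only [Finset.sum_sub_distrib]
    congr 1
    · rw [norm_horGrad_sq, jetLap, Finset.sum_mul_sum]
    · rw [horHess, Finset.sum_comm]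
      refine Finset.sum_congr rfl fun i _ => Finset.sum_congr rfl fun j _ => ?_
      rw [inner_e_horGrad, inner_e_horGrad]
      ring
  rw [h1, h2, h5, h6]
  ring

/-- The field `hessianField - (M / α) rellichField` points inwards along the boundary. -/
theorem fderiv_hessianField_sub_rellichField_nonpos {M α : ℝ} (hM : 0 < M) (hα : 0 < α)
    (hJ : J.2.1 = c • gradient φ g)
    (hH : ∀ τ, fderiv ℝ φ g τ = 0 →
      ⟪J.2.2 τ, τ⟫_ℝ = c * ⟪fderiv ℝ (gradient φ) g τ, τ⟫_ℝ)
    (hcurv : |‖G.horGrad φ g‖ ^ 2 * G.jetLap (g, jet φ g)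
      - G.horHess φ g (G.horGrad φ g) (G.horGrad φ g)| ≤ M * ‖G.horGrad φ g‖ ^ 3)
    (hstar : α * ‖G.horGrad φ g‖ ≤ fderiv ℝ φ g (G.dilationField g)) :
    fderiv ℝ φ g (G.hessianField (g, J) - (M / α) • G.rellichField (g, J)) ≤ 0 := by
  rw [map_sub, map_smul, smul_eq_mul, G.fderiv_rellichField hJ, G.fderiv_hessianField hJ hH,
    sub_nonpos]
  set r := ‖G.horGrad φ g‖
  calc _ ≤ c ^ 2 * (M * r ^ 3) :=
        mul_le_mul_of_nonneg_left ((le_abs_self _).trans hcurv) (sq_nonneg c)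
    _ = M / α * (c ^ 2 * r ^ 2 * (α * r)) := by field_simp
    _ ≤ _ := by gcongr

end

/-! ### The integral inequality -/

theorem nonempty_fin (G : StepTwoCarnot m 𝔤) : Nonempty (Fin m) := by
  by_contra h
  rw [not_nonempty_iff] at h
  refine G.V₂_ne_bot ?_
  rw [← G.bracket_V₁_V₁, Submodule.span_eq_bot]
  rintro _ ⟨x, hx, y, hy, rfl⟩
  rw [← G.sum_inner_smul_e hx]
  simp

variable [MeasurableSpace 𝔤] [BorelSpace 𝔤]

/-- Integration of a pointwise inequality. -/
theorem setIntegral_le_of_pointwise {Ω : Set 𝔤} (hΩ : MeasurableSet Ω)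
    {f f₁ f₂ d : 𝔤 → ℝ} (hf : IntegrableOn f Ω) (hf₁ : IntegrableOn f₁ Ω)
    (hf₂ : IntegrableOn f₂ Ω) (hd : IntegrableOn d Ω) (a b : ℝ) (h0 : ∫ g in Ω, d g ≤ 0)
    (h : ∀ g ∈ Ω, f g - a * f₁ g - b * f₂ g ≤ d g) :
    ∫ g in Ω, f g ≤ a * (∫ g in Ω, f₁ g) + b * ∫ g in Ω, f₂ g := by
  have i1 : IntegrableOn (fun g => a * f₁ g) Ω := hf₁.const_mul a
  have i2 : IntegrableOn (fun g => b * f₂ g) Ω := hf₂.const_mul b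
  have i3 : IntegrableOn (fun g => f g - a * f₁ g) Ω := hf.sub i1
  have h1 := (setIntegral_mono_on (i3.sub i2) hd hΩ h).trans h0
  simp only [Pi.sub_apply] at h1
  rw [integral_sub i3 i2, integral_sub hf i1, integral_const_mul, integral_const_mul] at h1
  linarith

end StepTwoCarnot

end

/-! ### Combination of the integral inequalities -/

theorem theoremT {m : ℕ} {𝔤 : Type*} [NormedAddCommGroup 𝔤] [InnerProductSpace ℝ 𝔤]
    [FiniteDimensional ℝ 𝔤] [MeasurableSpace 𝔤] [BorelSpace 𝔤] (G : StepTwoCarnot m 𝔤)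
    (Ω : Set 𝔤) (hb : Bornology.IsBounded Ω) (φ : 𝔤 → ℝ) (hφ : IsDefiningFunction φ Ω)
    (M α : ℝ) (hM : 0 < M) (hα : 0 < α)
    (hcurv : ∀ g ∈ frontier Ω, G.angle φ g ≠ 0 →
      ∀ h : ℝ, G.IsHorMeanCurvature Ω φ g h → |h| ≤ M)
    (hstar : ∀ g ∈ frontier Ω, α * G.angle φ g ≤ ⟪G.dilationField g, G.normal φ g⟫_ℝ) :
    ∃ C : ℝ, 0 < C ∧ ∀ u : 𝔤 → ℝ,
      G.FollandStein 3 u Ω → ContDiffOn ℝ 2 u (closure Ω) →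
      G.HConvexOn 2 u Ω → (∀ g ∈ frontier Ω, u g = 0) →
      (∑ i, ∑ j, ∫ g in Ω, (G.comm i j u g) ^ 2) ≤ C * ∫ g in Ω, (G.laplacian u g) ^ 2 := by
  obtain ⟨R, hR, hΩR⟩ : ∃ R : ℝ, 0 < R ∧ ∀ g ∈ Ω, ‖g‖ ≤ R := by
    obtain ⟨R, hR⟩ := hb.exists_norm_le
    exact ⟨max R 1, by positivity, fun g hg => (hR g hg).trans (le_max_left _ _)⟩
  obtain ⟨K, hK, hZK⟩ := G.exists_jetZ_sq_le R
  obtain ⟨i₀⟩ := G.nonempty_fin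
  set k : ℝ := M / α with hk
  have hk0 : 0 < k := div_pos hM hα
  set q : ℝ := |2 - G.homDim|
  have hq : 0 ≤ q := abs_nonneg _
  refine ⟨2 * ((1 / 4 + k * q) * (4 * R ^ 2) + 4 * k ^ 2 * K), by positivity,
    fun u _ hu hconv hu0 => ?_⟩
  have hm : MeasurableSet Ω := hφ.isOpen.measurableSet
  have huΩ : ContDiffOn ℝ 2 u Ω := hu.mono subset_closure
  have hug : ∀ g ∈ Ω, ContDiffAt ℝ 2 u g := fun g hg => huΩ.contDiffAt (hφ.isOpen.mem_nhds hg)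
  obtain ⟨j, hj, hju, hjb⟩ := hφ.exists_jet_extension hu hu0
  have hint : ∀ {f : 𝔤 × Jet 𝔤 → ℝ}, Continuous f → IntegrableOn (fun g => f (g, j g)) Ω :=
    fun hf => IsDefiningFunction.integrableOn hb (hf.comp_continuousOn (continuousOn_id.prodMk hj))
  have hcX := G.continuous_jetX
  have hcXX := G.continuous_jetXX
  have hcT := G.continuous_jetT
  have hcN : Continuous G.jetNormSq := by unfold StepTwoCarnot.jetNormSq; fun_prop
  have hcL : Continuous fun p => G.jetLap p ^ 2 := by unfold StepTwoCarnot.jetLap; fun_prop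
  have hcTS : Continuous G.jetTSq := by unfold StepTwoCarnot.jetTSq; fun_prop
  have hcU : Continuous fun p : 𝔤 × Jet 𝔤 => p.2.1 ^ 2 := by fun_prop
  have D1 := G.isDivergence_hessian.sub_smul G.isDivergence_rellich k
  have D2 := G.isDivergence_energy
  have D3 := G.isDivergence_poincare i₀
  have I1 := hφ.setIntegral_div_nonpos hb D1 huΩ hj hju fun g hg => by
    obtain ⟨-, c, hc, hH⟩ := hjb g hg
    have hd := hφ.fderiv_ne_zero g hg
    exact G.fderiv_hessianField_sub_rellichField_nonpos hM hα hc hH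
      (G.abs_norm_sq_mul_lap_sub_horHess_le hφ.contDiff hd (hcurv g hg))
      (G.mul_norm_horGrad_le hd (hstar g hg))
  have I2 := hφ.setIntegral_div_nonpos hb D2 huΩ hj hju fun g hg => by
    simp [StepTwoCarnot.energyField, (hjb g hg).1]
  have I3 := hφ.setIntegral_div_nonpos hb D3 huΩ hj hju fun g hg => by
    simp [StepTwoCarnot.poincareField, (hjb g hg).1]
  -- the square of `u` against the horizontal gradient
  have E3 := StepTwoCarnot.setIntegral_le_of_pointwise hm (hint hcU) (hint hcN) (hint hcN)
    ((hint D3.continuous_div).const_mul 2) (4 * R ^ 2) 0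
    (by rw [integral_const_mul]; linarith) fun g hg => by
      have h1 : G.jetX i₀ (g, j g) ^ 2 ≤ G.jetNormSq (g, j g) :=
        Finset.single_le_sum (f := fun i => G.jetX i (g, j g) ^ 2) (fun i _ => sq_nonneg _)
          (Finset.mem_univ i₀)
      have h2 : ⟪(G.e i₀ : 𝔤), g⟫_ℝ ^ 2 ≤ R ^ 2 := by
        have h3 : ‖(G.e i₀ : 𝔤)‖ = 1 := G.e.norm_eq_one i₀
        have h4 := abs_real_inner_le_norm (G.e i₀ : 𝔤) g
        rw [h3, one_mul] at h4
        rw [← sq_abs]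
        exact pow_le_pow_left₀ (abs_nonneg _) (h4.trans (hΩR g hg)) 2
      simp only [StepTwoCarnot.poincareDiv]
      have h5 := mul_le_mul h2 h1 (sq_nonneg _) (sq_nonneg R)
      -- Completing the square bounds -4 x u Xu by u² + 4 x² (Xu)², where x² ≤ R².
      nlinarith [sq_nonneg ((j g).1 + 2 * (⟪(G.e i₀ : 𝔤), g⟫_ℝ * G.jetX i₀ (g, j g)))]
  -- the horizontal gradient against the horizontal Laplacian
  have E2 := StepTwoCarnot.setIntegral_le_of_pointwise hm (hint hcN) (hint hcU) (hint hcL)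
    (hint D2.continuous_div) (1 / (8 * R ^ 2)) (2 * R ^ 2) I2 fun g hg => by
      simp only [StepTwoCarnot.energyDiv]
      -- The weight 1/(8R²) is chosen so that, by the Poincaré bound with constant 4R², the u² term
      -- costs exactly half of ∫ |∇ᴴu|².
      have h1 : 0 ≤ 1 / (8 * R ^ 2) * ((j g).1 + 4 * R ^ 2 * G.jetLap (g, j g)) ^ 2 := by
        positivity
      have h2 : 1 / (8 * R ^ 2) * ((j g).1 + 4 * R ^ 2 * G.jetLap (g, j g)) ^ 2
          = 1 / (8 * R ^ 2) * (j g).1 ^ 2 + (j g).1 * G.jetLap (g, j g)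
            + 2 * R ^ 2 * G.jetLap (g, j g) ^ 2 := by
        field_simp
        ring
      linarith
  -- Convexity leaves 3/4 of the squared commutators, and bounding Zu consumes 1/4 of them; the
  -- factor 2 normalizes the remaining half.
  have E1 := StepTwoCarnot.setIntegral_le_of_pointwise hm (hint hcTS) (hint hcN) (hint hcL)
    ((hint D1.continuous_div).const_mul 2) (2 * (1 / 4 + k * q)) (2 * (4 * k ^ 2 * K))
    (by rw [integral_const_mul]; linarith) fun g hg => by
      have h1 : 3 / 4 * G.jetTSq (g, j g) ≤ G.hessianDiv (g, j g) := by
        rw [hju g hg, G.hessianDiv_eq (hug g hg)]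
        linarith [hconv 2 (by norm_num) le_rfl g hg]
      have h2 := hZK (g, j g) (hΩR g hg)
      have h3 : (2 - G.homDim) * G.jetNormSq (g, j g) ≤ q * G.jetNormSq (g, j g) :=
        mul_le_mul_of_nonneg_right (le_abs_self _) (Finset.sum_nonneg fun i _ => sq_nonneg _)
      -- Young's inequality with weight 1/(4K), so that (Zu)² ≤ K(|∇ᴴu|² + ∑ (T_ij u)²) costs only
      -- 1/4 of each sum.
      have h4 : k * (2 * G.jetZ (g, j g) * G.jetLap (g, j g))
          ≤ 1 / (4 * K) * G.jetZ (g, j g) ^ 2 + 4 * k ^ 2 * K * G.jetLap (g, j g) ^ 2 := by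
        have h5 : 0 ≤ 1 / (4 * K) * (G.jetZ (g, j g) - 4 * k * K * G.jetLap (g, j g)) ^ 2 := by
          positivity
        have h6 : 1 / (4 * K) * (G.jetZ (g, j g) - 4 * k * K * G.jetLap (g, j g)) ^ 2
            = 1 / (4 * K) * G.jetZ (g, j g) ^ 2 + 4 * k ^ 2 * K * G.jetLap (g, j g) ^ 2
              - k * (2 * G.jetZ (g, j g) * G.jetLap (g, j g)) := by
          field_simp
          ring
        linarith
      have h7 : 1 / (4 * K) * G.jetZ (g, j g) ^ 2
          ≤ 1 / 4 * (G.jetNormSq (g, j g) + G.jetTSq (g, j g)) := by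
        calc _ ≤ 1 / (4 * K) * (K * (G.jetNormSq (g, j g) + G.jetTSq (g, j g))) := by gcongr
          _ = _ := by field_simp
      have h8 := mul_le_mul_of_nonneg_left h3 hk0.le
      simp only [StepTwoCarnot.rellichDiv]
      linarith
  have hT : ∑ i, ∑ l, ∫ g in Ω, (G.comm i l u g) ^ 2 = ∫ g in Ω, G.jetTSq (g, j g) := by
    have h1 : ∀ i l, ∫ g in Ω, (G.comm i l u g) ^ 2 = ∫ g in Ω, G.jetT i l (g, j g) ^ 2 :=
      fun i l => setIntegral_congr_fun hm fun g hg => by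
        simp only [hju g hg, G.comm_eq_jetT (hug g hg)]
    have h2 : ∀ i l, IntegrableOn (fun g => G.jetT i l (g, j g) ^ 2) Ω :=
      fun i l => hint (f := fun p => G.jetT i l p ^ 2) ((hcT i l).pow 2)
    simp only [h1, StepTwoCarnot.jetTSq]
    rw [integral_finsetSum _ fun i _ => integrable_finsetSum _ fun l _ => h2 i l]
    exact Finset.sum_congr rfl fun i _ => (integral_finsetSum _ fun l _ => h2 i l).symm
  have hL : ∫ g in Ω, (G.laplacian u g) ^ 2 = ∫ g in Ω, G.jetLap (g, j g) ^ 2 :=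
    setIntegral_congr_fun hm fun g hg => by
      simp only [hju g hg, StepTwoCarnot.laplacian, StepTwoCarnot.jetLap,
        G.X_X_eq_jetXX (hug g hg)]
  rw [hT, hL]
  set IT := ∫ g in Ω, G.jetTSq (g, j g)
  set IN := ∫ g in Ω, G.jetNormSq (g, j g)
  set IL := ∫ g in Ω, G.jetLap (g, j g) ^ 2
  set IU := ∫ g in Ω, (j g).1 ^ 2
  have F2 : IN ≤ 4 * R ^ 2 * IL := by
    have h1 : 1 / (8 * R ^ 2) * IU ≤ 1 / (8 * R ^ 2) * (4 * R ^ 2 * IN + 0 * IN) :=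
      mul_le_mul_of_nonneg_left E3 (by positivity)
    have h2 : 1 / (8 * R ^ 2) * (4 * R ^ 2 * IN + 0 * IN) = IN / 2 := by
      field_simp
      ring
    linarith
  calc IT ≤ 2 * (1 / 4 + k * q) * IN + 2 * (4 * k ^ 2 * K) * IL := E1
    _ ≤ 2 * (1 / 4 + k * q) * (4 * R ^ 2 * IL) + 2 * (4 * k ^ 2 * K) * IL := by gcongr
    _ = _ := by ring
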